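/- Let $n\ge 2$ and let $B_1,\dots,B_m$ be $n\times n$ complex symmetric matrices ($B_r^t=B_r$). Write $[X,Y]=XY-YX$ and let $\|X\|^2=\operatorname{tr}(XX^*)$ be the squared Frobenius norm. Then $$\sum_{r,s=1}^m\|[B_r,B_s]\|^2\le\Big(\sum_{r=1}^m\|B_r\|^2\Big)^2 .$$ For $1\le r\le m$ put $A_r^1=\tfrac12(B_r+\overline{B_r})$ and $A_r^2=\tfrac1{2\mathbf i}(B_r-\overline{B_r})$, where the bar is entrywise complex conjugation, and let $(C_1,\dots,C_{2m})=(A_1^1,\dots,A_m^1,A_1^2,\dots,A_m^2)$. Equality holds if and only if $\sum_{r=1}^m[B_r,\overline{B_r}]=0$ and there are real orthogonal matrices $P\in O(n)$ and $R=(R_{jk})\in O(2m)$ and a real number $\lambda\ge0$ such that $$\Big(\sum_{j=1}^{2m}R_{j1}P^*C_jP,\ \dots,\ \sum_{j=1}^{2m}R_{j,2m}P^*C_jP\Big)=\big(\operatorname{diag}(H_1,0),\operatorname{diag}(H_2,0),0,\dots,0\big),$$ where $$H_1=\begin{pmatrix}\lambda&0\\0&-\lambda\end{pmatrix},\qquad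 H_2=\begin{pmatrix}0&\lambda\\\lambda&0\end{pmatrix},$$ and $\operatorname{diag}(H,0)$ is the $n\times n$ matrix with upper left block $H$ and all other entries zero. -/

import Mathlib

open scoped Matrix.Norms.Frobenius

namespace ComplexDDVV

/-- The `n × n` block matrix `diag(H, 0)` whose upper left `2 × 2` block is `H` and whose other
entries are zero (used for `2 ≤ n`). -/
noncomputable def diagZero (n : ℕ) (H : Matrix (Fin 2) (Fin 2) ℂ) : Matrix (Fin n) (Fin n) ℂ :=
  Matrix.of fun i j =>
    if h : i.val < 2 ∧ j.val < 2 then H ⟨i.val, h.1⟩ ⟨j.val, h.2⟩ else 0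

/-- The matrix `H₁ = (l, 0; 0, -l)`. -/
noncomputable def H₁ (l : ℝ) : Matrix (Fin 2) (Fin 2) ℂ := !![(l : ℂ), 0; 0, -(l : ℂ)]

/-- The matrix `H₂ = (0, l; l, 0)`. -/
noncomputable def H₂ (l : ℝ) : Matrix (Fin 2) (Fin 2) ℂ := !![0, (l : ℂ); (l : ℂ), 0]

/-- The tuple `(diag(H₁, 0), diag(H₂, 0), 0, …, 0)` of length `M` (used for `2 ≤ M`). -/
noncomputable def standardTuple (n M : ℕ) (l : ℝ) : Fin M → Matrix (Fin n) (Fin n) ℂ := fun k =>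
  if k.val = 0 then diagZero n (H₁ l) else if k.val = 1 then diagZero n (H₂ l) else 0

/-- The formula for the action of a pair `(P, R)` in `U(n) × O(M)` on a tuple of matrices:
the `k`-th entry of the result is `∑ j, R j k • (P* A j P)`. -/
noncomputable def kAct {n M : ℕ} (P : Matrix (Fin n) (Fin n) ℂ) (R : Matrix (Fin M) (Fin M) ℝ)
    (A : Fin M → Matrix (Fin n) (Fin n) ℂ) : Fin M → Matrix (Fin n) (Fin n) ℂ := fun k =>
  ∑ j, R j k • (P.conjTranspose * A j * P)

/-- The entrywise complex conjugate of a matrix. -/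
noncomputable def conjMatrix {n : ℕ} (B : Matrix (Fin n) (Fin n) ℂ) : Matrix (Fin n) (Fin n) ℂ :=
  B.map (starRingEnd ℂ)

/-- The real part `(B + conj B) / 2`, as a complex matrix with real entries. -/
noncomputable def rePart {n : ℕ} (B : Matrix (Fin n) (Fin n) ℂ) : Matrix (Fin n) (Fin n) ℂ :=
  (1 / 2 : ℂ) • (B + conjMatrix B)

/-- The imaginary part `(B - conj B) / (2 i)`, as a complex matrix with real entries. -/
noncomputable def imPart {n : ℕ} (B : Matrix (Fin n) (Fin n) ℂ) : Matrix (Fin n) (Fin n) ℂ :=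
  (1 / (2 * Complex.I) : ℂ) • (B - conjMatrix B)

end ComplexDDVV

/-! Write `B r = X r + i Y r` with real symmetric `X r`, `Y r`. By the Jacobi identity, the sum of
`‖[B r, B s]‖²` is the same sum for the `2m` real matrices minus `2‖∑ [X r, Y r]‖²`
(`sum_norm_lie_sq`). So everything follows from the real DDVV inequality and its equality case; the
subtracted term accounts for the condition `∑ [B r, conj (B r)] = 0`.

For real symmetric tuples both sides are invariant under orthogonal recombination, so the members
may be taken pairwise orthogonal. With directions fixed, the left side is a quadratic form in the
squared norms (`lieTotal_eq_quadForm`). At its maximum on the simplex, the first-order condition at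
the largest coordinate reduces the bound to Lu's inequality (`weighted_sum_le`). To prove that,
diagonalise `X`: commutation multiplies entry `(i, j)` by an eigenvalue gap, Bessel bounds the total
square of an off-diagonal entry by `1/2`, and `excess_le_two` remains. There the gaps above one form
a star, and the Laplacian of a star with `k` leaves has largest eigenvalue `k + 1`.

At equality, Lu's inequality is sharp at every nonzero member, so two members tie for the largest
norm. In an eigenbasis of one, the other lives on gaps of at least one; these contain no triangle,
so its cube has trace zero. In its own eigenbasis the star then has a single leaf and the normalized
eigenvalues are `±1/√2` and zeros. All other members live on one symmetric pair of entries, where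
orthogonality leaves room for only one (`exists_of_extremal`). -/

namespace ComplexDDVV

/-! ### Gaps between the coordinates of a vector in the unit ball -/

section Spread

variable {ι : Type*} [Fintype ι] [DecidableEq ι] {x : ι → ℝ}

theorem sq_add_sq_le_one (hx : ∑ i, x i ^ 2 ≤ 1) {i j : ι} (hij : i ≠ j) :
    x i ^ 2 + x j ^ 2 ≤ 1 := by
  have h := Finset.sum_le_sum_of_subset_of_nonneg (f := fun i => x i ^ 2)
    (Finset.subset_univ {i, j}) (fun _ _ _ => sq_nonneg _)
  rw [Finset.sum_pair hij] at h
  linarith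

theorem sub_sq_le_two (hx : ∑ i, x i ^ 2 ≤ 1) (i j : ι) : (x i - x j) ^ 2 ≤ 2 := by
  by_cases hij : i = j
  · simp [hij]
  · nlinarith [sq_add_sq_le_one hx hij, sq_nonneg (x i + x j)]

/-- There is no triangle of pairwise distances at least one. -/
theorem not_triangle (hx : ∑ i, x i ^ 2 ≤ 1) {i j k : ι} (hij : 1 ≤ (x i - x j) ^ 2)
    (hjk : 1 ≤ (x j - x k) ^ 2) (hki : 1 ≤ (x k - x i) ^ 2) : False := by
  have h1 := sub_sq_le_two hx i j
  have h2 := sub_sq_le_two hx j k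
  have h3 := sub_sq_le_two hx k i
  rw [one_le_sq_iff_one_le_abs, le_abs'] at hij hjk hki
  -- The three differences sum to zero, so two share a sign and the third has absolute value at
  -- least 2, although its square is at most 2.
  rcases hij with a | a <;> rcases hjk with b | b <;> rcases hki with c | c <;>
    first | linarith | nlinarith

/-- Head-to-tail pairs would span a difference above 2, and four distinct indices would violate `(a
- b)² ≤ 2(a² + b²)`. Hence two long pairs share their upper or their lower end. -/
theorem eq_or_eq_of_one_lt_sub (hx : ∑ i, x i ^ 2 ≤ 1) {i j k l : ι} (hij : 1 < x i - x j)
    (hkl : 1 < x k - x l) : i = k ∨ j = l := by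
  by_contra! h
  obtain ⟨hik, hjl⟩ := h
  have hij' : i ≠ j := by rintro rfl; linarith
  have hkl' : k ≠ l := by rintro rfl; linarith
  have hjk : j ≠ k := by
    rintro rfl
    nlinarith [sub_sq_le_two hx i l]
  have hil : i ≠ l := by
    rintro rfl
    nlinarith [sub_sq_le_two hx k j]
  have h := Finset.sum_le_sum_of_subset_of_nonneg (f := fun i => x i ^ 2)
    (Finset.subset_univ {i, j, k, l}) (fun _ _ _ => sq_nonneg _)
  rw [Finset.sum_insert (by simp [*]), Finset.sum_insert (by simp [*]),
    Finset.sum_pair hkl'] at h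
  nlinarith [sq_nonneg (x i + x j), sq_nonneg (x k + x l)]

/-- The pairs of coordinates at distance more than one form a star. -/
theorem exists_star (hx : ∑ i, x i ^ 2 ≤ 1) {p q : ι} (hpq : 1 < (x p - x q) ^ 2) :
    ∃ (c : ι) (J : Finset ι), c ∉ J ∧
      ∀ i j, 1 < (x i - x j) ^ 2 ↔ (i = c ∧ j ∈ J) ∨ (j = c ∧ i ∈ J) := by
  have key : ∀ i j, 1 < (x i - x j) ^ 2 ↔ 1 < x i - x j ∨ 1 < x j - x i := by
    intro i j
    rw [one_lt_sq_iff_one_lt_abs, lt_abs, neg_sub]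
  obtain ⟨a, b, hab⟩ : ∃ a b, 1 < x a - x b := by
    rcases (key p q).1 hpq with h | h
    exacts [⟨_, _, h⟩, ⟨_, _, h⟩]
  by_cases hall : ∀ i j, 1 < x i - x j → i = a
  · refine ⟨a, Finset.univ.filter fun j => 1 < x a - x j, by simp, fun i j => ?_⟩
    rw [key]
    simp only [Finset.mem_filter, Finset.mem_univ, true_and]
    constructor
    · rintro (h | h)
      · exact Or.inl ⟨hall _ _ h, hall _ _ h ▸ h⟩
      · exact Or.inr ⟨hall _ _ h, hall _ _ h ▸ h⟩
    · rintro (⟨rfl, h⟩ | ⟨rfl, h⟩)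
      exacts [Or.inl h, Or.inr h]
  -- Two long pairs with different upper ends `a`, `c` share their lower end, which is the centre: a
  -- long pair ending elsewhere would have to start at both `a` and `c`.
  · push Not at hall
    obtain ⟨c, d, hcd, hca⟩ := hall
    have hdb : d = b := (eq_or_eq_of_one_lt_sub hx hcd hab).resolve_left hca
    subst hdb
    have hall : ∀ i j, 1 < x i - x j → j = d := by
      intro i j h
      rcases eq_or_eq_of_one_lt_sub hx h hab with h1 | h1
      · rcases eq_or_eq_of_one_lt_sub hx h hcd with h2 | h2
        · exact absurd (h2.symm.trans h1) hca
        · exact h2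
      · exact h1
    refine ⟨d, Finset.univ.filter fun j => 1 < x j - x d, by simp, fun i j => ?_⟩
    rw [key]
    simp only [Finset.mem_filter, Finset.mem_univ, true_and]
    constructor
    · rintro (h | h)
      · exact Or.inr ⟨hall _ _ h, hall _ _ h ▸ h⟩
      · exact Or.inl ⟨hall _ _ h, hall _ _ h ▸ h⟩
    · rintro (⟨rfl, h⟩ | ⟨rfl, h⟩)
      exacts [Or.inr h, Or.inl h]

/-- The total excess over one of the squared distances between coordinates. -/
noncomputable def excess (x : ι → ℝ) : ℝ := ∑ i, ∑ j, max ((x i - x j) ^ 2 - 1) 0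

omit [DecidableEq ι] in
theorem excess_eq_zero (h : ∀ i j, (x i - x j) ^ 2 ≤ 1) : excess x = 0 :=
  Finset.sum_eq_zero fun i _ => Finset.sum_eq_zero fun j _ =>
    max_eq_right (by linarith [h i j])

theorem excess_eq_of_star {c : ι} {J : Finset ι} (hc : c ∉ J)
    (h : ∀ i j, 1 < (x i - x j) ^ 2 ↔ (i = c ∧ j ∈ J) ∨ (j = c ∧ i ∈ J)) :
    excess x = 2 * ∑ j ∈ J, ((x c - x j) ^ 2 - 1) := by
  have hmax : ∀ i j, max ((x i - x j) ^ 2 - 1) 0 =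
      (if i = c then if j ∈ J then (x c - x j) ^ 2 - 1 else 0 else 0) +
        if j = c then if i ∈ J then (x c - x i) ^ 2 - 1 else 0 else 0 := by
    intro i j
    by_cases hij : 1 < (x i - x j) ^ 2
    · rw [max_eq_left (by linarith)]
      rcases (h i j).1 hij with ⟨rfl, hj⟩ | ⟨rfl, hi⟩
      · simp [hj, hc]
      · simp [hi, hc]
        ring
    · rw [max_eq_right (by linarith)]
      have hn := mt (h i j).2 hij
      push Not at hn
      by_cases h1 : i = c
      · by_cases h2 : j = c
        · subst h1; subst h2; simp [hc]
        · simp [h1, h2, hn.1 h1]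
      · by_cases h2 : j = c
        · simp [h1, h2, hn.2 h2]
        · simp [h1, h2]
  unfold excess
  simp only [hmax, Finset.sum_add_distrib]
  rw [Finset.sum_comm (s := Finset.univ) (t := Finset.univ)
    (f := fun i j => if i = c then if j ∈ J then (x c - x j) ^ 2 - 1 else 0 else 0)]
  simp only [Finset.sum_ite_eq', Finset.mem_univ, if_true]
  rw [Finset.sum_ite_mem, Finset.univ_inter]
  ring

omit [Fintype ι] [DecidableEq ι] in
-- The right side is a square plus a Cauchy–Schwarz defect, so this exhibits `|J| + 1` as an upper
-- bound for the star Laplacian and keeps the equality conditions visible.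
theorem star_identity (c : ι) (J : Finset ι) :
    (J.card + 1) * (x c ^ 2 + ∑ j ∈ J, x j ^ 2) - ∑ j ∈ J, (x c - x j) ^ 2 =
      (x c + ∑ j ∈ J, x j) ^ 2 + (J.card * ∑ j ∈ J, x j ^ 2 - (∑ j ∈ J, x j) ^ 2) := by
  have : ∑ j ∈ J, (x c - x j) ^ 2 =
      J.card * x c ^ 2 - 2 * x c * ∑ j ∈ J, x j + ∑ j ∈ J, x j ^ 2 := by
    rw [Finset.mul_sum, ← nsmul_eq_mul, ← Finset.sum_const, ← Finset.sum_sub_distrib,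
      ← Finset.sum_add_distrib]
    exact Finset.sum_congr rfl fun j _ => by ring
  rw [this]
  ring

theorem star_sq_sum_le (hx : ∑ i, x i ^ 2 ≤ 1) {c : ι} {J : Finset ι} (hc : c ∉ J) :
    x c ^ 2 + ∑ j ∈ J, x j ^ 2 ≤ 1 := by
  rw [← Finset.sum_insert (f := fun j => x j ^ 2) hc]
  exact (Finset.sum_le_sum_of_subset_of_nonneg (Finset.subset_univ _)
    (fun _ _ _ => sq_nonneg _)).trans hx

/-- The star contributes at most `(k + 1) - k = 1`, and each pair is counted in both orders. -/
theorem excess_le_two (hx : ∑ i, x i ^ 2 ≤ 1) : excess x ≤ 2 := by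
  by_cases h : ∀ i j, (x i - x j) ^ 2 ≤ 1
  · rw [excess_eq_zero h]; norm_num
  · push Not at h
    obtain ⟨p, q, hpq⟩ := h
    obtain ⟨c, J, hc, hJ⟩ := exists_star hx hpq
    rw [excess_eq_of_star hc hJ, Finset.sum_sub_distrib, Finset.sum_const, nsmul_eq_mul]
    have h1 := star_identity (x := x) c J
    have h2 := star_sq_sum_le hx hc
    have h3 := sq_sum_le_card_mul_sum_sq (s := J) (f := x)
    have h4 : ((J.card : ℝ) + 1) * (x c ^ 2 + ∑ j ∈ J, x j ^ 2) ≤ (J.card + 1) * 1 := by gcongr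
    nlinarith [sq_nonneg (x c + ∑ j ∈ J, x j)]

/-- The extremal configurations for `excess_le_two` with vanishing third moment. -/
theorem exists_of_two_le_excess (hx : ∑ i, x i ^ 2 ≤ 1) (h2 : 2 ≤ excess x)
    (h3 : ∑ i, x i ^ 3 = 0) :
    ∃ i j, i ≠ j ∧ 0 < x i ∧ 2 * x i ^ 2 = 1 ∧ x j = -x i ∧ ∀ k, k ≠ i → k ≠ j → x k = 0 := by
  by_cases h : ∀ i j, (x i - x j) ^ 2 ≤ 1
  · rw [excess_eq_zero h] at h2; norm_num at h2
  push Not at h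
  obtain ⟨p, q, hpq⟩ := h
  obtain ⟨c, J, hc, hJ⟩ := exists_star hx hpq
  rw [excess_eq_of_star hc hJ, Finset.sum_sub_distrib, Finset.sum_const, nsmul_eq_mul] at h2
  have e1 := star_identity (x := x) c J
  have e2 := star_sq_sum_le hx hc
  have e3 := sq_sum_le_card_mul_sum_sq (s := J) (f := x)
  have hk : (0 : ℝ) ≤ J.card := Nat.cast_nonneg _
  set k : ℝ := (J.card : ℝ) with hkdef
  set s := ∑ j ∈ J, x j with hs
  set Q := ∑ j ∈ J, x j ^ 2 with hQ
  -- Each estimate behind `excess_le_two` must now be an equality: all mass lies on the star, its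
  -- sum is zero, and Cauchy–Schwarz on the leaves is sharp.
  have hsum : x c ^ 2 + Q = 1 := by nlinarith [sq_nonneg (x c + s)]
  have hcs : x c + s = 0 := by
    have : (x c + s) ^ 2 ≤ 0 := by rw [hsum] at e1; nlinarith
    exact pow_eq_zero_iff (two_ne_zero) |>.1 (le_antisymm this (sq_nonneg _))
  have hkQ : k * Q = s ^ 2 := by
    rw [hsum] at e1; nlinarith [sq_nonneg (x c + s)]
  have hout : ∀ i, i ≠ c → i ∉ J → x i = 0 := by
    intro i hi hiJ
    have hle := star_sq_sum_le hx (c := i) (J := insert c J) (by simp [hi, hiJ])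
    rw [Finset.sum_insert hc] at hle
    exact pow_eq_zero_iff (two_ne_zero) |>.1 (le_antisymm (by linarith) (sq_nonneg _))
  have hleaf : ∀ j ∈ J, k * x j = s := by
    have hz : ∑ j ∈ J, (k * x j - s) ^ 2 = 0 := by
      have : ∑ j ∈ J, (k * x j - s) ^ 2 = k ^ 2 * Q - 2 * k * s * s + k * s ^ 2 := by
        rw [hQ, Finset.mul_sum, hkdef, ← nsmul_eq_mul (a := s ^ 2), ← Finset.sum_const]
        conv_rhs => rw [hs]
        rw [Finset.mul_sum (a := 2 * (J.card : ℝ) * ∑ j ∈ J, x j), ← Finset.sum_sub_distrib,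
          ← Finset.sum_add_distrib]
        exact Finset.sum_congr rfl fun j _ => by rw [hs]; ring
      rw [this]
      linear_combination k * hkQ
    intro j hj
    have := (Finset.sum_eq_zero_iff_of_nonneg (fun _ _ => sq_nonneg _)).1 hz j hj
    exact sub_eq_zero.1 (pow_eq_zero_iff (two_ne_zero) |>.1 this)
  have hxc : x c ≠ 0 := by
    intro h0
    have : s = 0 := by linarith
    have hQ1 : Q = 1 := by rw [h0] at hsum; linarith
    have hk0 : J.card = 0 := by
      rw [hQ1, this] at hkQ
      have hk0 : k = 0 := by linarith
      rw [hkdef] at hk0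
      exact_mod_cast hk0
    rw [Finset.card_eq_zero] at hk0
    rw [hQ, hk0] at hQ1
    simp at hQ1
  have hcube : x c ^ 3 + ∑ j ∈ J, x j ^ 3 = 0 := by
    rw [← Finset.sum_insert (f := fun j => x j ^ 3) hc, ← h3]
    refine Finset.sum_subset (Finset.subset_univ _) fun i _ hi => ?_
    simp only [Finset.mem_insert, not_or] at hi
    rw [hout i hi.1 hi.2]; norm_num
  -- All leaves equal `-x c / k`, so the third moment is `x c ^ 3 * (1 - 1 / k ^ 2)`; its vanishing
  -- leaves one leaf.
  have hk1 : k = 1 := by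
    have h4 : k ^ 3 * ∑ j ∈ J, x j ^ 3 = k * s ^ 3 := by
      rw [Finset.mul_sum, hkdef, ← nsmul_eq_mul, ← Finset.sum_const]
      refine Finset.sum_congr rfl fun j hj => ?_
      rw [← hleaf j hj, hkdef]; ring
    have hs' : s = -x c := by linarith
    have h5 : k * (k - 1) * (k + 1) * x c ^ 3 = 0 := by
      rw [hs'] at h4
      linear_combination k ^ 3 * hcube - h4
    have hk0 : k ≠ 0 := by
      intro h0
      rw [h0, zero_mul, hs'] at hkQ
      exact hxc (pow_eq_zero_iff (two_ne_zero) |>.1 (by linarith : x c ^ 2 = 0))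
    have hk2 : k + 1 ≠ 0 := by positivity
    have h6 : k - 1 = 0 := by
      by_contra h7
      exact mul_ne_zero (mul_ne_zero (mul_ne_zero hk0 h7) hk2) (pow_ne_zero 3 hxc) h5
    linarith
  obtain ⟨j, hj⟩ : ∃ j, J = {j} := Finset.card_eq_one.1 (by
    rw [hkdef] at hk1
    exact_mod_cast hk1)
  have hcj : c ≠ j := by rintro rfl; simp [hj] at hc
  have hxj : x j = -x c := by
    have := hleaf j (by simp [hj])
    rw [hk1, one_mul] at this
    linarith
  have hsq : 2 * x c ^ 2 = 1 := by
    rw [hQ, hj, Finset.sum_singleton, hxj] at hsum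
    linarith
  have hrest : ∀ i, i ≠ c → i ≠ j → x i = 0 := fun i h1 h2 => hout i h1 (by simp [hj, h2])
  rcases lt_or_gt_of_ne hxc with hneg | hpos
  · exact ⟨j, c, hcj.symm, by linarith, by rw [hxj]; linarith, by linarith,
      fun i h1 h2 => hrest i h2 h1⟩
  · exact ⟨c, j, hcj, hpos, hsq, hxj, hrest⟩

end Spread

/-! ### Frobenius geometry of real matrices and Lu's inequality -/

section RealMatrices

open Matrix

variable {ι κ : Type*} [Fintype ι]

/-- The Frobenius inner product of real matrices. -/
def fip (X Y : Matrix ι ι ℝ) : ℝ := ∑ i, ∑ j, X i j * Y i j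

theorem fip_eq_trace (X Y : Matrix ι ι ℝ) : fip X Y = (Xᵀ * Y).trace := by
  simp only [fip, Matrix.trace, Matrix.diag, Matrix.mul_apply, Matrix.transpose_apply]
  exact Finset.sum_comm

theorem fip_comm (X Y : Matrix ι ι ℝ) : fip X Y = fip Y X := by
  simp only [fip, mul_comm]

theorem fip_self_nonneg (X : Matrix ι ι ℝ) : 0 ≤ fip X X :=
  Finset.sum_nonneg fun _ _ => Finset.sum_nonneg fun _ _ => mul_self_nonneg _

theorem fip_self_eq_zero {X : Matrix ι ι ℝ} : fip X X = 0 ↔ X = 0 := by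
  refine ⟨fun h => ?_, by rintro rfl; simp [fip]⟩
  ext i j
  have h1 := (Finset.sum_eq_zero_iff_of_nonneg (fun _ _ =>
    Finset.sum_nonneg fun _ _ => mul_self_nonneg _)).1 h i (Finset.mem_univ _)
  have h2 := (Finset.sum_eq_zero_iff_of_nonneg (fun _ _ => mul_self_nonneg _)).1 h1 j
    (Finset.mem_univ _)
  simpa using h2

theorem fip_smul_left (r : ℝ) (X Y : Matrix ι ι ℝ) : fip (r • X) Y = r * fip X Y := by
  simp [fip, Finset.mul_sum, mul_assoc]

theorem fip_smul_right (r : ℝ) (X Y : Matrix ι ι ℝ) : fip X (r • Y) = r * fip X Y := by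
  rw [fip_comm, fip_smul_left, fip_comm]

theorem fip_sum_left (s : Finset κ) (F : κ → Matrix ι ι ℝ) (Y : Matrix ι ι ℝ) :
    fip (∑ a ∈ s, F a) Y = ∑ a ∈ s, fip (F a) Y := by
  simp only [fip_eq_trace, Matrix.transpose_sum, Finset.sum_mul, Matrix.trace_sum]

theorem fip_sum_right (s : Finset κ) (F : κ → Matrix ι ι ℝ) (Y : Matrix ι ι ℝ) :
    fip Y (∑ a ∈ s, F a) = ∑ a ∈ s, fip Y (F a) := by
  rw [fip_comm, fip_sum_left]
  simp only [fip_comm]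

variable [DecidableEq ι]

theorem fip_conj {U : Matrix ι ι ℝ} (hU : U ∈ orthogonalGroup ι ℝ) (X Y : Matrix ι ι ℝ) :
    fip (Uᵀ * X * U) (Uᵀ * Y * U) = fip X Y := by
  have h : U * Uᵀ = 1 := (mem_orthogonalGroup_iff ι ℝ).1 hU
  have : (Uᵀ * X * U)ᵀ * (Uᵀ * Y * U) = Uᵀ * (Xᵀ * Y * U) := by
    simp only [transpose_mul, transpose_transpose, Matrix.mul_assoc]
    rw [← Matrix.mul_assoc U Uᵀ, h, Matrix.one_mul]
  rw [fip_eq_trace, this, trace_mul_comm, Matrix.mul_assoc, h, Matrix.mul_one, ← fip_eq_trace]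

theorem lie_conj {U : Matrix ι ι ℝ} (hU : U ∈ orthogonalGroup ι ℝ) (X Y : Matrix ι ι ℝ) :
    ⁅Uᵀ * X * U, Uᵀ * Y * U⁆ = Uᵀ * ⁅X, Y⁆ * U := by
  have h : U * Uᵀ = 1 := (mem_orthogonalGroup_iff ι ℝ).1 hU
  have aux : ∀ X Y : Matrix ι ι ℝ, (Uᵀ * X * U) * (Uᵀ * Y * U) = Uᵀ * (X * Y) * U := by
    intro X Y
    simp only [Matrix.mul_assoc]
    rw [← Matrix.mul_assoc U Uᵀ, h, Matrix.one_mul]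
  rw [Ring.lie_def, Ring.lie_def, aux, aux, Matrix.mul_sub, Matrix.sub_mul]

omit [Fintype ι] [DecidableEq ι] in
theorem isSymm_transpose_mul_mul [Fintype ι] {X : Matrix ι ι ℝ} (hX : X.IsSymm)
    (U : Matrix ι ι ℝ) : (Uᵀ * X * U).IsSymm := by
  rw [Matrix.IsSymm, transpose_mul, transpose_mul, transpose_transpose, hX.eq, Matrix.mul_assoc]

theorem exists_orthogonal_diagonal {X : Matrix ι ι ℝ} (hX : X.IsSymm) :
    ∃ U ∈ orthogonalGroup ι ℝ, ∃ x : ι → ℝ, Uᵀ * X * U = diagonal x := by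
  have hH : X.IsHermitian := by
    rw [Matrix.IsHermitian, conjTranspose_eq_transpose_of_trivial, hX.eq]
  refine ⟨hH.eigenvectorUnitary, hH.eigenvectorUnitary.2, hH.eigenvalues, ?_⟩
  have h := hH.conjStarAlgAut_star_eigenvectorUnitary
  rw [Unitary.conjStarAlgAut_apply] at h
  simpa [Matrix.star_eq_conjTranspose] using h

theorem fip_lie_diagonal (x : ι → ℝ) (E : Matrix ι ι ℝ) :
    fip ⁅diagonal x, E⁆ ⁅diagonal x, E⁆ = ∑ i, ∑ j, (x i - x j) ^ 2 * E i j ^ 2 := by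
  refine Finset.sum_congr rfl fun i _ => Finset.sum_congr rfl fun j _ => ?_
  rw [Ring.lie_def, Matrix.sub_apply, diagonal_mul, mul_diagonal]
  ring

/-- Bessel's inequality for an off-diagonal entry of an orthogonal family of symmetric matrices. -/
theorem sum_entry_sq_le_half [Fintype κ] {E : κ → Matrix ι ι ℝ} (hE : ∀ a, (E a).IsSymm)
    (ho : ∀ a b, a ≠ b → fip (E a) (E b) = 0) (hn : ∀ a, fip (E a) (E a) ≤ 1)
    {i j : ι} (hij : i ≠ j) : ∑ a, E a i j ^ 2 ≤ 1 / 2 := by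
  classical
  set w := ∑ a, E a i j ^ 2 with hw
  -- By symmetry the sum `w` appears in `Z` at both `(i, j)` and `(j, i)`, so `2w² ≤ ‖Z‖² ≤ w`; this
  -- is where the factor `1/2` comes from.
  set Z : Matrix ι ι ℝ := ∑ a, E a i j • E a with hZ
  have hZij : Z i j = w := by
    rw [hZ, Matrix.sum_apply, hw]
    exact Finset.sum_congr rfl fun a _ => by rw [Matrix.smul_apply, smul_eq_mul, sq]
  have hZji : Z j i = w := by
    rw [hZ, Matrix.sum_apply, hw]
    exact Finset.sum_congr rfl fun a _ => by
      rw [Matrix.smul_apply, smul_eq_mul, (hE a).apply, sq]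
  have hZZ : fip Z Z ≤ w := by
    have : fip Z Z = ∑ a, E a i j ^ 2 * fip (E a) (E a) := by
      rw [hZ, fip_sum_left]
      refine Finset.sum_congr rfl fun a _ => ?_
      rw [fip_smul_left, fip_sum_right, Finset.sum_eq_single a, fip_smul_right]
      · ring
      · intro b _ hb
        rw [fip_smul_right, ho a b hb.symm, mul_zero]
      · simp
    rw [this, hw]
    exact Finset.sum_le_sum fun a _ => mul_le_of_le_one_right (sq_nonneg _) (hn a)
  have hge : Z i j ^ 2 + Z j i ^ 2 ≤ fip Z Z := by
    have h1 : ∀ k l, Z k l ^ 2 ≤ ∑ m, Z k m * Z k m := fun k l => by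
      rw [sq]
      exact Finset.single_le_sum (f := fun m => Z k m * Z k m) (fun _ _ => mul_self_nonneg _)
        (Finset.mem_univ l)
    have h2 := Finset.sum_le_sum_of_subset_of_nonneg (f := fun k => ∑ m, Z k m * Z k m)
      (Finset.subset_univ {i, j})
      (fun _ _ _ => Finset.sum_nonneg fun _ _ => mul_self_nonneg _)
    rw [Finset.sum_pair hij] at h2
    exact (add_le_add (h1 i j) (h1 j i)).trans h2
  rw [hZij, hZji] at hge
  nlinarith

section WeightedFamily

variable [Fintype κ] {E : κ → Matrix ι ι ℝ} {x : ι → ℝ} {s : Finset κ} {a : κ → ℝ} {w : ℝ}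

omit [Fintype κ] in
-- Commutation with `diagonal x` scales entry `(i, j)` by `x i - x j`, so only gaps above one can
-- contribute positively.
theorem weighted_sum_eq : ∑ b ∈ s, a b * (fip ⁅diagonal x, E b⁆ ⁅diagonal x, E b⁆ -
    fip (E b) (E b)) = ∑ i, ∑ j, ((x i - x j) ^ 2 - 1) * ∑ b ∈ s, a b * E b i j ^ 2 := by
  have h1 : ∀ b ∈ s, a b * (fip ⁅diagonal x, E b⁆ ⁅diagonal x, E b⁆ - fip (E b) (E b)) =
      ∑ i, ∑ j, ((x i - x j) ^ 2 - 1) * (a b * E b i j ^ 2) := by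
    intro b _
    rw [fip_lie_diagonal, fip, ← Finset.sum_sub_distrib, Finset.mul_sum]
    refine Finset.sum_congr rfl fun i _ => ?_
    rw [← Finset.sum_sub_distrib, Finset.mul_sum]
    exact Finset.sum_congr rfl fun j _ => by ring
  rw [Finset.sum_congr rfl h1, Finset.sum_comm]
  refine Finset.sum_congr rfl fun i _ => ?_
  rw [Finset.sum_comm]
  exact Finset.sum_congr rfl fun j _ => by rw [Finset.mul_sum]

theorem max_mul_weight_le (hE : ∀ a, (E a).IsSymm)
    (ho : ∀ a b, a ≠ b → fip (E a) (E b) = 0) (hn : ∀ a, fip (E a) (E a) ≤ 1)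
    (hw : 0 ≤ w) (ha : ∀ b ∈ s, a b ≤ w) (i j : ι) :
    max ((x i - x j) ^ 2 - 1) 0 * ∑ b ∈ s, a b * E b i j ^ 2 ≤
      max ((x i - x j) ^ 2 - 1) 0 * (w / 2) := by
  by_cases hij : i = j
  · simp [hij]
  · refine mul_le_mul_of_nonneg_left ?_ (le_max_right _ _)
    calc ∑ b ∈ s, a b * E b i j ^ 2 ≤ ∑ b ∈ s, w * E b i j ^ 2 :=
          Finset.sum_le_sum fun b hb => mul_le_mul_of_nonneg_right (ha b hb) (sq_nonneg _)
      _ ≤ ∑ b, w * E b i j ^ 2 := Finset.sum_le_sum_of_subset_of_nonneg (Finset.subset_univ _)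
          fun _ _ _ => mul_nonneg hw (sq_nonneg _)
      _ = w * ∑ b, E b i j ^ 2 := by rw [Finset.mul_sum]
      _ ≤ w * (1 / 2) := mul_le_mul_of_nonneg_left (sum_entry_sq_le_half hE ho hn hij) hw
      _ = w / 2 := by ring

theorem sum_max_mul_weight_le (hE : ∀ a, (E a).IsSymm)
    (ho : ∀ a b, a ≠ b → fip (E a) (E b) = 0) (hn : ∀ a, fip (E a) (E a) ≤ 1)
    (hw : 0 ≤ w) (ha : ∀ b ∈ s, a b ≤ w) :
    ∑ i, ∑ j, max ((x i - x j) ^ 2 - 1) 0 * ∑ b ∈ s, a b * E b i j ^ 2 ≤ excess x * (w / 2) := by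
  rw [excess, Finset.sum_mul]
  refine Finset.sum_le_sum fun i _ => ?_
  rw [Finset.sum_mul]
  exact Finset.sum_le_sum fun j _ => max_mul_weight_le hE ho hn hw ha i j

omit [Fintype κ] [DecidableEq ι] [Fintype ι] in
theorem sub_one_mul_weight_le (ha0 : ∀ b ∈ s, 0 ≤ a b) (i j : ι) :
    ((x i - x j) ^ 2 - 1) * ∑ b ∈ s, a b * E b i j ^ 2 ≤
      max ((x i - x j) ^ 2 - 1) 0 * ∑ b ∈ s, a b * E b i j ^ 2 :=
  mul_le_mul_of_nonneg_right (le_max_left _ _)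
    (Finset.sum_nonneg fun b hb => mul_nonneg (ha0 b hb) (sq_nonneg _))

theorem weighted_sum_diagonal_le (hx : ∑ i, x i ^ 2 ≤ 1) (hE : ∀ a, (E a).IsSymm)
    (ho : ∀ a b, a ≠ b → fip (E a) (E b) = 0) (hn : ∀ a, fip (E a) (E a) ≤ 1)
    (hw : 0 ≤ w) (ha0 : ∀ b ∈ s, 0 ≤ a b) (ha : ∀ b ∈ s, a b ≤ w) :
    ∑ b ∈ s, a b * (fip ⁅diagonal x, E b⁆ ⁅diagonal x, E b⁆ - fip (E b) (E b)) ≤ w := by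
  rw [weighted_sum_eq]
  have h1 := sum_max_mul_weight_le (x := x) hE ho hn hw ha
  have h2 := excess_le_two hx
  have h3 := Finset.sum_le_sum fun i (_ : i ∈ Finset.univ) =>
    Finset.sum_le_sum fun j (_ : j ∈ Finset.univ) =>
      sub_one_mul_weight_le (x := x) (E := E) ha0 i j
  nlinarith

theorem two_le_excess_of_weighted_sum (hE : ∀ a, (E a).IsSymm)
    (ho : ∀ a b, a ≠ b → fip (E a) (E b) = 0) (hn : ∀ a, fip (E a) (E a) ≤ 1)
    (hw : 0 < w) (ha0 : ∀ b ∈ s, 0 ≤ a b) (ha : ∀ b ∈ s, a b ≤ w)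
    (heq : w ≤ ∑ b ∈ s, a b * (fip ⁅diagonal x, E b⁆ ⁅diagonal x, E b⁆ - fip (E b) (E b))) :
    2 ≤ excess x := by
  rw [weighted_sum_eq] at heq
  have h1 := sum_max_mul_weight_le (x := x) hE ho hn hw.le ha
  have h3 := Finset.sum_le_sum fun i (_ : i ∈ Finset.univ) =>
    Finset.sum_le_sum fun j (_ : j ∈ Finset.univ) =>
      sub_one_mul_weight_le (x := x) (E := E) ha0 i j
  by_contra! h
  nlinarith

/-- Sharpness makes the replacement of each factor by its positive part lossless. A strictly
negative factor therefore multiplies zero; gaps of exactly one carry no information. -/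
theorem entry_eq_zero_of_weighted_sum (hx : ∑ i, x i ^ 2 ≤ 1) (hE : ∀ a, (E a).IsSymm)
    (ho : ∀ a b, a ≠ b → fip (E a) (E b) = 0) (hn : ∀ a, fip (E a) (E a) ≤ 1)
    (hw : 0 < w) (ha0 : ∀ b ∈ s, 0 ≤ a b) (ha : ∀ b ∈ s, a b ≤ w)
    (heq : w ≤ ∑ b ∈ s, a b * (fip ⁅diagonal x, E b⁆ ⁅diagonal x, E b⁆ - fip (E b) (E b)))
    {b : κ} (hb : b ∈ s) (hab : 0 < a b) {i j : ι} (hij : (x i - x j) ^ 2 < 1) :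
    E b i j = 0 := by
  rw [weighted_sum_eq] at heq
  have h1 := sum_max_mul_weight_le (x := x) hE ho hn hw.le ha
  have h2 := excess_le_two hx
  have h3 : ∀ i j, 0 ≤ max ((x i - x j) ^ 2 - 1) 0 * ∑ b ∈ s, a b * E b i j ^ 2 -
      ((x i - x j) ^ 2 - 1) * ∑ b ∈ s, a b * E b i j ^ 2 := fun i j =>
    sub_nonneg.2 (sub_one_mul_weight_le ha0 i j)
  have h4 : ∑ i, ∑ j, (max ((x i - x j) ^ 2 - 1) 0 * ∑ b ∈ s, a b * E b i j ^ 2 -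
      ((x i - x j) ^ 2 - 1) * ∑ b ∈ s, a b * E b i j ^ 2) = 0 := by
    refine le_antisymm ?_ (Finset.sum_nonneg fun i _ => Finset.sum_nonneg fun j _ => h3 i j)
    simp only [Finset.sum_sub_distrib]
    nlinarith
  have h5 := (Finset.sum_eq_zero_iff_of_nonneg (fun i _ =>
    Finset.sum_nonneg fun j _ => h3 i j)).1 h4 i (Finset.mem_univ _)
  have h6 := (Finset.sum_eq_zero_iff_of_nonneg (fun j _ => h3 i j)).1 h5 j (Finset.mem_univ _)
  rw [max_eq_right (by linarith), zero_mul, zero_sub, neg_eq_zero, mul_eq_zero] at h6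
  have h7 := h6.resolve_left (by linarith)
  have h8 := (Finset.sum_eq_zero_iff_of_nonneg
    (fun b hb => mul_nonneg (ha0 b hb) (sq_nonneg (E b i j)))).1 h7 b hb
  simpa [hab.ne'] using h8

end WeightedFamily

theorem fip_diagonal (x : ι → ℝ) : fip (diagonal x) (diagonal x) = ∑ i, x i ^ 2 := by
  refine Finset.sum_congr rfl fun i _ => ?_
  rw [Finset.sum_eq_single i]
  · simp [sq]
  · intro j _ hj; simp [hj.symm]
  · simp

/-- Lu's inequality. -/
theorem weighted_sum_le [Fintype κ] {E : κ → Matrix ι ι ℝ} {X : Matrix ι ι ℝ} {s : Finset κ}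
    {a : κ → ℝ} {w : ℝ} (hX : X.IsSymm) (hX1 : fip X X ≤ 1) (hE : ∀ a, (E a).IsSymm)
    (ho : ∀ a b, a ≠ b → fip (E a) (E b) = 0) (hn : ∀ a, fip (E a) (E a) ≤ 1)
    (hw : 0 ≤ w) (ha0 : ∀ b ∈ s, 0 ≤ a b) (ha : ∀ b ∈ s, a b ≤ w) :
    ∑ b ∈ s, a b * (fip ⁅X, E b⁆ ⁅X, E b⁆ - fip (E b) (E b)) ≤ w := by
  obtain ⟨U, hU, x, hx⟩ := exists_orthogonal_diagonal hX
  have h := weighted_sum_diagonal_le (x := x) (E := fun b => Uᵀ * E b * U) (s := s) (a := a)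
    (w := w) ?_ (fun b => isSymm_transpose_mul_mul (hE b) U) ?_ ?_ hw ha0 ha
  · simpa only [← hx, lie_conj hU, fip_conj hU] using h
  · rwa [← fip_diagonal, ← hx, fip_conj hU]
  · intro b c hbc
    rw [fip_conj hU, ho b c hbc]
  · intro b
    rw [fip_conj hU]
    exact hn b

end RealMatrices

/-! ### Maximising a quadratic form over the simplex -/

section QuadraticForm

variable {κ : Type*} [Fintype κ] [DecidableEq κ] {c : κ → κ → ℝ}

/-- The quadratic form with coefficients `c`. -/
def quadForm (c : κ → κ → ℝ) (x : κ → ℝ) : ℝ := ∑ a, ∑ b, x a * x b * c a b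

/-- The zero diagonal of `c` removes the `t²` term. -/
theorem quadForm_add_single (hc : ∀ a b, c a b = c b a) (h0 : ∀ a, c a a = 0) (x : κ → ℝ) (p : κ)
    (t : ℝ) : quadForm c (x + Pi.single p t) = quadForm c x + 2 * t * ∑ b, x b * c p b := by
  have h1 : ∀ a b, (x + Pi.single p t : κ → ℝ) a * (x + Pi.single p t : κ → ℝ) b * c a b =
      x a * x b * c a b + (if a = p then t * (x b * c p b) else 0) +
        if b = p then t * (x a * c p a) else 0 := by
    intro a b
    by_cases ha : a = p <;> by_cases hb : b = p
    · subst ha; subst hb; simp [h0]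
    · subst ha; simp [hb]; ring
    · subst hb; simp [ha, hc a b]; ring
    · simp [ha, hb]
  simp only [quadForm, h1, Finset.sum_add_distrib]
  rw [Finset.sum_comm (f := fun a b => if a = p then t * (x b * c p b) else 0)]
  simp only [Finset.sum_ite_eq', Finset.mem_univ, if_true, ← Finset.mul_sum]
  ring

theorem eq_zero_of_linear_add_sq_nonneg {v F r : ℝ} (hr : 0 < r)
    (h : ∀ t, |t| ≤ r → 0 ≤ v * t + F * t ^ 2) : v = 0 := by
  have hmin : IsLocalMin (fun t : ℝ => v * t + F * t ^ 2) 0 := by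
    filter_upwards [Metric.ball_mem_nhds (0 : ℝ) hr] with t ht
    rw [Metric.mem_ball, Real.dist_eq, sub_zero] at ht
    simpa using h t ht.le
  have hd : HasDerivAt (fun t : ℝ => v * t + F * t ^ 2) v 0 := by
    have := ((hasDerivAt_id' (0 : ℝ)).const_mul v).fun_add
      (((hasDerivAt_id' (0 : ℝ)).fun_pow 2).const_mul F)
    simpa using this
  exact hmin.hasDerivAt_eq_zero hd

/-- First-order condition at a nonnegative vector where `quadForm c ≤ F * (∑ ·) ^ 2` is sharp. -/
theorem sum_mul_eq_of_extremal (hc : ∀ a b, c a b = c b a) (h0 : ∀ a, c a a = 0) {F : ℝ}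
    (hF : ∀ y : κ → ℝ, (∀ a, 0 ≤ y a) → quadForm c y ≤ F * (∑ a, y a) ^ 2) {x : κ → ℝ}
    (hx : ∀ a, 0 ≤ x a) (heq : quadForm c x = F * (∑ a, x a) ^ 2) {p : κ} (hp : 0 < x p) :
    ∑ b, x b * c p b = F * ∑ a, x a := by
  have h : 2 * (F * ∑ a, x a - ∑ b, x b * c p b) = 0 := by
    -- Since `x p > 0`, coordinate `p` may move by `t` in both directions up to `x p` without
    -- leaving the nonnegative vectors.
    refine eq_zero_of_linear_add_sq_nonneg (F := F) hp fun t ht => ?_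
    have h1 := hF (x + Pi.single p t) fun a => by
      by_cases ha : a = p
      · subst ha
        simp only [Pi.add_apply, Pi.single_eq_same]
        linarith [neg_abs_le t]
      · simpa [ha] using hx a
    rw [quadForm_add_single hc h0, heq] at h1
    simp only [Pi.add_apply, Finset.sum_add_distrib, Finset.sum_pi_single', Finset.mem_univ,
      if_true] at h1
    linarith
  linarith

omit [DecidableEq κ] in
theorem quadForm_smul (t : ℝ) (x : κ → ℝ) : quadForm c (t • x) = t ^ 2 * quadForm c x := by
  simp only [quadForm, Finset.mul_sum, Pi.smul_apply, smul_eq_mul]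
  exact Finset.sum_congr rfl fun _ _ => Finset.sum_congr rfl fun _ _ => by ring

/-- Let `F` be the maximum on the simplex, attained at `x` with largest coordinate `x p`. The
first-order condition is `∑ x b * c p b = F`, and `hkey` with `w = x p` reads `F - (1 - x p) ≤ x p`,
that is `F ≤ 1`. -/
theorem quadForm_le_sq_sum (hc : ∀ a b, c a b = c b a) (h0 : ∀ a, c a a = 0)
    (hkey : ∀ (p : κ) (x : κ → ℝ) (w : ℝ), 0 ≤ w → (∀ b, 0 ≤ x b) → (∀ b, x b ≤ w) →
      ∑ b ∈ Finset.univ.erase p, x b * (c p b - 1) ≤ w)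
    (y : κ → ℝ) (hy : ∀ a, 0 ≤ y a) : quadForm c y ≤ (∑ a, y a) ^ 2 := by
  have hzero : ∀ y : κ → ℝ, (∀ a, 0 ≤ y a) → ∑ a, y a = 0 → quadForm c y = 0 := by
    intro y hy hs
    have := (Finset.sum_eq_zero_iff_of_nonneg (fun a _ => hy a)).1 hs
    exact Finset.sum_eq_zero fun a ha => Finset.sum_eq_zero fun b _ => by rw [this a ha]; ring
  rcases isEmpty_or_nonempty κ with he | hne
  · simp [quadForm]
  have hcont : Continuous (quadForm c) := by unfold quadForm; fun_prop
  obtain ⟨x, hxm, hmax⟩ := (isCompact_stdSimplex ℝ κ).exists_isMaxOn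
    ⟨_, single_mem_stdSimplex ℝ (Classical.arbitrary κ)⟩ hcont.continuousOn
  set F := quadForm c x with hFdef
  have hF : ∀ y : κ → ℝ, (∀ a, 0 ≤ y a) → quadForm c y ≤ F * (∑ a, y a) ^ 2 := by
    intro y hy
    rcases (Finset.sum_nonneg fun a (_ : a ∈ Finset.univ) => hy a).eq_or_lt with hs | hs
    · rw [hzero y hy hs.symm, ← hs]; simp
    · have hm : (∑ a, y a)⁻¹ • y ∈ stdSimplex ℝ κ :=
        ⟨fun a => mul_nonneg (inv_nonneg.2 hs.le) (hy a), by
          simp only [Pi.smul_apply, smul_eq_mul, ← Finset.mul_sum]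
          exact inv_mul_cancel₀ hs.ne'⟩
      have h1 : quadForm c ((∑ a, y a)⁻¹ • y) ≤ F := hmax hm
      rw [quadForm_smul, inv_pow, inv_mul_le_iff₀ (by positivity)] at h1
      linarith
  obtain ⟨p, -, hp⟩ := Finset.exists_max_image Finset.univ x Finset.univ_nonempty
  have hx1 := hxm.2
  have hpp : 0 < x p := by
    by_contra! h
    have : ∑ a, x a ≤ 0 := Finset.sum_nonpos fun a ha => (hp a ha).trans h
    linarith
  have h1 := sum_mul_eq_of_extremal hc h0 hF hxm.1 (by rw [hx1]; ring) hpp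
  have h2 := hkey p x (x p) hpp.le hxm.1 fun b => hp b (Finset.mem_univ _)
  have h3 : F ≤ 1 := by
    rw [← Finset.add_sum_erase _ _ (Finset.mem_univ p), h0, mul_zero, zero_add, hx1, mul_one] at h1
    rw [← Finset.add_sum_erase _ _ (Finset.mem_univ p)] at hx1
    simp only [mul_sub, mul_one, Finset.sum_sub_distrib] at h2
    linarith
  nlinarith [hF y hy, sq_nonneg (∑ a, y a)]

end QuadraticForm

/-! ### Orthogonal recombination of tuples -/

section Tuples

open Matrix

variable {ι κ : Type*} [Fintype ι] [DecidableEq ι] [Fintype κ]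

/-- The total squared norm of a tuple of real matrices. -/
def normTotal (A : κ → Matrix ι ι ℝ) : ℝ := ∑ a, fip (A a) (A a)

/-- The total squared norm of the commutators of a tuple of real matrices. -/
def lieTotal (A : κ → Matrix ι ι ℝ) : ℝ := ∑ a, ∑ b, fip ⁅A a, A b⁆ ⁅A a, A b⁆

/-- The linear recombination of a tuple by a square matrix. -/
def recombine (R : Matrix κ κ ℝ) (A : κ → Matrix ι ι ℝ) : κ → Matrix ι ι ℝ :=
  fun k => ∑ j, R j k • A j

omit [DecidableEq ι] in
-- The Gram matrix transforms by congruence: its trace is invariant under orthogonal `R`, and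
-- diagonalising it makes the tuple orthogonal.
theorem fip_recombine (R : Matrix κ κ ℝ) (A : κ → Matrix ι ι ℝ) (k l : κ) :
    fip (recombine R A k) (recombine R A l) =
      (Rᵀ * Matrix.of (fun a b => fip (A a) (A b)) * R) k l := by
  simp only [recombine, fip_sum_left, fip_sum_right, fip_smul_left, fip_smul_right,
    Matrix.mul_apply, Matrix.transpose_apply, Matrix.of_apply, Finset.sum_mul, Finset.mul_sum]
  exact Finset.sum_congr rfl fun _ _ => Finset.sum_congr rfl fun _ _ => by ring

omit [DecidableEq ι] [Fintype ι] in
theorem isSymm_recombine {A : κ → Matrix ι ι ℝ} (hA : ∀ k, (A k).IsSymm) (R : Matrix κ κ ℝ)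
    (k : κ) : (recombine R A k).IsSymm := by
  simp only [recombine, Matrix.IsSymm, transpose_sum, transpose_smul, (hA _).eq]

omit [DecidableEq ι] in
theorem normTotal_eq_trace (A : κ → Matrix ι ι ℝ) :
    normTotal A = (Matrix.of fun a b => fip (A a) (A b)).trace := rfl

variable [DecidableEq κ]

omit [DecidableEq ι] in
theorem normTotal_recombine {R : Matrix κ κ ℝ} (hR : R ∈ orthogonalGroup κ ℝ)
    (A : κ → Matrix ι ι ℝ) : normTotal (recombine R A) = normTotal A := by
  have h : R * Rᵀ = 1 := (mem_orthogonalGroup_iff κ ℝ).1 hR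
  simp only [normTotal_eq_trace, fip_recombine]
  rw [show (Matrix.of fun a b => (Rᵀ * Matrix.of (fun a b => fip (A a) (A b)) * R) a b) =
    Rᵀ * Matrix.of (fun a b => fip (A a) (A b)) * R from rfl, Matrix.mul_assoc, trace_mul_comm,
    Matrix.mul_assoc, h, Matrix.mul_one]

omit [Fintype κ] [DecidableEq κ] [DecidableEq ι] in
theorem fip_lie_comm (X Y : Matrix ι ι ℝ) : fip ⁅X, Y⁆ ⁅X, Y⁆ = fip ⁅Y, X⁆ ⁅Y, X⁆ := by
  simp only [fip, Ring.lie_def, Matrix.sub_apply]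
  exact Finset.sum_congr rfl fun _ _ => Finset.sum_congr rfl fun _ _ => by ring

omit [DecidableEq ι] in
-- For fixed `Y` the map `X ↦ ⁅X, Y⁆` is linear, so norm invariance applies in each slot separately.
theorem lieTotal_recombine {R : Matrix κ κ ℝ} (hR : R ∈ orthogonalGroup κ ℝ)
    (A : κ → Matrix ι ι ℝ) : lieTotal (recombine R A) = lieTotal A := by
  have h1 : ∀ Y : Matrix ι ι ℝ, ∑ k, fip ⁅recombine R A k, Y⁆ ⁅recombine R A k, Y⁆ =
      ∑ k, fip ⁅A k, Y⁆ ⁅A k, Y⁆ := by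
    intro Y
    have : ∀ k, ⁅recombine R A k, Y⁆ = recombine R (fun j => ⁅A j, Y⁆) k := by
      intro k
      simp only [recombine, Ring.lie_def, Finset.sum_mul, Finset.mul_sum, Matrix.smul_mul,
        Matrix.mul_smul, smul_sub, Finset.sum_sub_distrib]
    simp only [this]
    exact normTotal_recombine hR _
  unfold lieTotal
  rw [Finset.sum_comm]
  simp only [h1]
  rw [Finset.sum_comm]
  refine Finset.sum_congr rfl fun k _ => ?_
  simp only [fip_lie_comm (A k)]
  exact h1 (A k)

omit [DecidableEq ι] in
/-- Every tuple can be rotated to an orthogonal one. -/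
theorem exists_recombine_orthogonal (A : κ → Matrix ι ι ℝ) :
    ∃ R ∈ orthogonalGroup κ ℝ, ∀ k l, k ≠ l → fip (recombine R A k) (recombine R A l) = 0 := by
  obtain ⟨R, hR, x, hx⟩ := exists_orthogonal_diagonal
    (X := Matrix.of fun a b => fip (A a) (A b)) (by ext a b; exact fip_comm _ _)
  exact ⟨R, hR, fun k l hkl => by rw [fip_recombine, hx, diagonal_apply_ne _ hkl]⟩

end Tuples

/-! ### The real DDVV inequality and its extremal orthogonal tuples -/

section RealInequality

open Matrix

variable {ι κ : Type*} [Fintype ι]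

/-- The tuple of normalized matrices; zero matrices stay zero. -/
noncomputable def normalized (A : κ → Matrix ι ι ℝ) : κ → Matrix ι ι ℝ :=
  fun a => (√(fip (A a) (A a)))⁻¹ • A a

theorem sqrt_smul_normalized (A : κ → Matrix ι ι ℝ) (a : κ) :
    √(fip (A a) (A a)) • normalized A a = A a := by
  by_cases h : fip (A a) (A a) = 0
  · rw [fip_self_eq_zero.1 h]; simp [normalized, fip_self_eq_zero.1 h]
  · have : √(fip (A a) (A a)) ≠ 0 := by
      rw [Real.sqrt_ne_zero (fip_self_nonneg _)]; exact h
    rw [normalized, smul_smul, mul_inv_cancel₀ this, one_smul]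

theorem isSymm_normalized {A : κ → Matrix ι ι ℝ} (hA : ∀ a, (A a).IsSymm) (a : κ) :
    (normalized A a).IsSymm := (hA a).smul _

theorem fip_normalized_ne {A : κ → Matrix ι ι ℝ} (ho : ∀ a b, a ≠ b → fip (A a) (A b) = 0)
    (a b : κ) (hab : a ≠ b) : fip (normalized A a) (normalized A b) = 0 := by
  rw [normalized, normalized, fip_smul_left, fip_smul_right, ho a b hab, mul_zero, mul_zero]

theorem fip_normalized_self {A : κ → Matrix ι ι ℝ} {a : κ} (h : fip (A a) (A a) ≠ 0) :
    fip (normalized A a) (normalized A a) = 1 := by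
  have h0 : √(fip (A a) (A a)) ≠ 0 := by
    rw [Real.sqrt_ne_zero (fip_self_nonneg _)]; exact h
  have h1 := Real.mul_self_sqrt (fip_self_nonneg (A a))
  rw [normalized, fip_smul_left, fip_smul_right]
  field_simp
  rw [sq, h1]

theorem fip_normalized_self_le (A : κ → Matrix ι ι ℝ) (a : κ) :
    fip (normalized A a) (normalized A a) ≤ 1 := by
  by_cases h : fip (A a) (A a) = 0
  · simp [normalized, fip_self_eq_zero.1 h, fip]
  · rw [fip_normalized_self h]

variable [DecidableEq ι]

omit [DecidableEq ι] in
theorem fip_lie_smul (r s : ℝ) (X Y : Matrix ι ι ℝ) :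
    fip ⁅r • X, s • Y⁆ ⁅r • X, s • Y⁆ = r ^ 2 * s ^ 2 * fip ⁅X, Y⁆ ⁅X, Y⁆ := by
  have : ⁅r • X, s • Y⁆ = (r * s) • ⁅X, Y⁆ := by
    simp only [Ring.lie_def, Matrix.smul_mul, Matrix.mul_smul, smul_smul, smul_sub]
    rw [mul_comm s r]
  rw [this, fip_smul_left, fip_smul_right]
  ring

/-- The squared norms of the commutators of the normalized tuple. -/
noncomputable def lieCoeff (A : κ → Matrix ι ι ℝ) (a b : κ) : ℝ :=
  fip ⁅normalized A a, normalized A b⁆ ⁅normalized A a, normalized A b⁆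

omit [DecidableEq ι] in
theorem lieCoeff_comm (A : κ → Matrix ι ι ℝ) (a b : κ) : lieCoeff A a b = lieCoeff A b a :=
  fip_lie_comm _ _

omit [DecidableEq ι] in
theorem lieCoeff_self (A : κ → Matrix ι ι ℝ) (a : κ) : lieCoeff A a a = 0 := by
  rw [lieCoeff, Ring.lie_def, sub_self, fip_self_eq_zero]

variable [Fintype κ]

omit [DecidableEq ι] in
theorem lieTotal_eq_quadForm (A : κ → Matrix ι ι ℝ) :
    lieTotal A = quadForm (lieCoeff A) fun a => fip (A a) (A a) := by
  refine Finset.sum_congr rfl fun a _ => Finset.sum_congr rfl fun b _ => ?_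
  conv_lhs => rw [← sqrt_smul_normalized A a, ← sqrt_smul_normalized A b]
  rw [fip_lie_smul, Real.sq_sqrt (fip_self_nonneg _), Real.sq_sqrt (fip_self_nonneg _), lieCoeff]

variable [DecidableEq κ]

/-- The weights `y` are arbitrary, not just the actual squared norms, because the equality case
perturbs them. -/
theorem quadForm_lieCoeff_le {A : κ → Matrix ι ι ℝ} (hA : ∀ a, (A a).IsSymm)
    (ho : ∀ a b, a ≠ b → fip (A a) (A b) = 0) (y : κ → ℝ) (hy : ∀ a, 0 ≤ y a) :
    quadForm (lieCoeff A) y ≤ (∑ a, y a) ^ 2 := by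
  refine quadForm_le_sq_sum (lieCoeff_comm A) (lieCoeff_self A) (fun p x w hw hx0 hxw => ?_) y hy
  -- Replacing `1` by the squared norm of the normalized matrix changes something only for zero
  -- members, and only upwards.
  refine le_trans (Finset.sum_le_sum fun b _ => mul_le_mul_of_nonneg_left
    (sub_le_sub_left (fip_normalized_self_le A b) _) (hx0 b)) ?_
  exact weighted_sum_le (isSymm_normalized hA p) (fip_normalized_self_le A p)
    (isSymm_normalized hA) (fip_normalized_ne ho) (fip_normalized_self_le A) hw
    (fun b _ => hx0 b) (fun b _ => hxw b)

/-- The DDVV inequality for real symmetric matrices. -/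
theorem lieTotal_le_normTotal_sq {A : κ → Matrix ι ι ℝ} (hA : ∀ a, (A a).IsSymm) :
    lieTotal A ≤ normTotal A ^ 2 := by
  obtain ⟨R, hR, ho⟩ := exists_recombine_orthogonal A
  rw [← lieTotal_recombine hR, ← normTotal_recombine hR, lieTotal_eq_quadForm]
  exact quadForm_lieCoeff_le (isSymm_recombine hA R) ho _ fun a => fip_self_nonneg _

/-- At an extremal tuple, Lu's inequality is sharp for every nonzero member. -/
theorem le_weighted_sum_of_extremal {A : κ → Matrix ι ι ℝ} (hA : ∀ a, (A a).IsSymm)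
    (ho : ∀ a b, a ≠ b → fip (A a) (A b) = 0) (heq : lieTotal A = normTotal A ^ 2) {p : κ}
    (hp : 0 < fip (A p) (A p)) :
    fip (A p) (A p) ≤ ∑ b ∈ Finset.univ.erase p, fip (A b) (A b) *
      (fip ⁅normalized A p, normalized A b⁆ ⁅normalized A p, normalized A b⁆ -
        fip (normalized A b) (normalized A b)) := by
  have h1 := sum_mul_eq_of_extremal (F := 1) (lieCoeff_comm A) (lieCoeff_self A)
    (fun y hy => by rw [one_mul]; exact quadForm_lieCoeff_le hA ho y hy)
    (x := fun a => fip (A a) (A a)) (fun a => fip_self_nonneg _)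
    (by rw [← lieTotal_eq_quadForm, heq, one_mul, normTotal]) hp
  have h2 : ∑ b ∈ Finset.univ.erase p, fip (A b) (A b) * (lieCoeff A p b - 1) ≤
      ∑ b ∈ Finset.univ.erase p, fip (A b) (A b) *
        (lieCoeff A p b - fip (normalized A b) (normalized A b)) :=
    Finset.sum_le_sum fun b _ => mul_le_mul_of_nonneg_left
      (sub_le_sub_left (fip_normalized_self_le A b) _) (fip_self_nonneg _)
  refine le_trans ?_ h2
  rw [← Finset.add_sum_erase _ _ (Finset.mem_univ p), lieCoeff_self, mul_zero, zero_add, one_mul,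
    ← Finset.add_sum_erase _ _ (Finset.mem_univ p)] at h1
  simp only [mul_sub, mul_one, Finset.sum_sub_distrib]
  linarith

omit [DecidableEq κ] [Fintype κ] in
-- A nonzero term `Y i k * Y k j * Y j i` would be a triangle of gaps at least one.
theorem trace_cube_eq_zero {x : ι → ℝ} (hx : ∑ i, x i ^ 2 ≤ 1) {Y : Matrix ι ι ℝ}
    (hY : ∀ i j, (x i - x j) ^ 2 < 1 → Y i j = 0) : (Y * Y * Y).trace = 0 := by
  simp only [Matrix.trace, Matrix.diag, Matrix.mul_apply, Finset.sum_mul]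
  refine Finset.sum_eq_zero fun i _ => Finset.sum_eq_zero fun k _ =>
    Finset.sum_eq_zero fun j _ => ?_
  by_contra h
  have h1 : ∀ a b, Y a b ≠ 0 → 1 ≤ (x a - x b) ^ 2 := fun a b hab => by
    by_contra! hlt
    exact hab (hY a b hlt)
  have h2 := mul_ne_zero_iff.1 h
  have h3 := mul_ne_zero_iff.1 h2.1
  exact not_triangle hx (h1 _ _ h3.1) (h1 _ _ h3.2) (h1 _ _ h2.2)

omit [Fintype κ] [DecidableEq κ] in
theorem trace_cube_conj {U : Matrix ι ι ℝ} (hU : U ∈ orthogonalGroup ι ℝ) (X : Matrix ι ι ℝ) :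
    ((Uᵀ * X * U) * (Uᵀ * X * U) * (Uᵀ * X * U)).trace = (X * X * X).trace := by
  have h : U * Uᵀ = 1 := (mem_orthogonalGroup_iff ι ℝ).1 hU
  have : (Uᵀ * X * U) * (Uᵀ * X * U) * (Uᵀ * X * U) = Uᵀ * (X * X * X * U) := by
    simp only [Matrix.mul_assoc]
    rw [← Matrix.mul_assoc U Uᵀ, h, Matrix.one_mul, ← Matrix.mul_assoc U Uᵀ, h, Matrix.one_mul]
  rw [this, trace_mul_comm, Matrix.mul_assoc, h, Matrix.mul_one]

/-- The symmetric matrix with entries `y` at `(i, j)` and `(j, i)`. -/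
def pairMatrix (i j : ι) (y : ℝ) : Matrix ι ι ℝ :=
  Matrix.of fun k l => if (k = i ∧ l = j) ∨ (k = j ∧ l = i) then y else 0

omit [Fintype ι] [Fintype κ] [DecidableEq κ] in
theorem eq_pairMatrix {i j : ι} {X : Matrix ι ι ℝ} (hX : X.IsSymm)
    (h : ∀ k l, ¬((k = i ∧ l = j) ∨ (k = j ∧ l = i)) → X k l = 0) :
    X = pairMatrix i j (X i j) := by
  ext k l
  rw [pairMatrix, Matrix.of_apply]
  split_ifs with hkl
  · rcases hkl with ⟨rfl, rfl⟩ | ⟨rfl, rfl⟩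
    · rfl
    · exact hX.apply _ _
  · exact h k l hkl

omit [Fintype κ] [DecidableEq κ] in
theorem fip_pairMatrix {i j : ι} (hij : i ≠ j) (y z : ℝ) :
    fip (pairMatrix i j y) (pairMatrix i j z) = 2 * (y * z) := by
  have h : ∀ k l, pairMatrix i j y k l * pairMatrix i j z k l =
      (if k = i then if l = j then y * z else 0 else 0) +
        if k = j then if l = i then y * z else 0 else 0 := by
    intro k l
    rw [pairMatrix, pairMatrix, Matrix.of_apply, Matrix.of_apply]
    by_cases h1 : k = i
    · have : k ≠ j := fun h => hij (h1.symm.trans h)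
      by_cases h2 : l = j <;> simp [h1, h2, hij]
    · by_cases h2 : k = j <;> by_cases h3 : l = i <;>
        simp [h1, h2, h3, hij.symm]
  simp only [fip, h, Finset.sum_add_distrib]
  have h2 : ∀ i j : ι, ∑ k, ∑ l, (if k = i then if l = j then y * z else 0 else 0) = y * z := by
    intro i j
    rw [Finset.sum_comm]
    simp
  rw [h2, h2]
  ring

/-- Lu's inequality at a member `p` of largest norm of an extremal tuple, in an eigenbasis. -/
theorem extremal_in_eigenbasis {A : κ → Matrix ι ι ℝ} (hA : ∀ a, (A a).IsSymm)
    (ho : ∀ a b, a ≠ b → fip (A a) (A b) = 0) (heq : lieTotal A = normTotal A ^ 2) {p : κ}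
    (hp : 0 < fip (A p) (A p)) (hmax : ∀ b, fip (A b) (A b) ≤ fip (A p) (A p))
    {U : Matrix ι ι ℝ} (hU : U ∈ orthogonalGroup ι ℝ) {x : ι → ℝ}
    (hx : Uᵀ * normalized A p * U = diagonal x) :
    ∑ i, x i ^ 2 = 1 ∧ 2 ≤ excess x ∧ ∀ b, b ≠ p → 0 < fip (A b) (A b) → ∀ i j,
      (x i - x j) ^ 2 < 1 → (Uᵀ * normalized A b * U) i j = 0 := by
  have h1 := le_weighted_sum_of_extremal hA ho heq hp
  have hx1 : ∑ i, x i ^ 2 = 1 := by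
    rw [← fip_diagonal, ← hx, fip_conj hU, fip_normalized_self hp.ne']
  have hE := fun b => isSymm_transpose_mul_mul (isSymm_normalized hA b) U
  have ho' : ∀ a b, a ≠ b →
      fip (Uᵀ * normalized A a * U) (Uᵀ * normalized A b * U) = 0 := fun a b hab => by
    rw [fip_conj hU, fip_normalized_ne ho a b hab]
  have hn' : ∀ a, fip (Uᵀ * normalized A a * U) (Uᵀ * normalized A a * U) ≤ 1 := fun a => by
    rw [fip_conj hU]
    exact fip_normalized_self_le A a
  have h2 : fip (A p) (A p) ≤ ∑ b ∈ Finset.univ.erase p, fip (A b) (A b) *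
      (fip ⁅diagonal x, Uᵀ * normalized A b * U⁆ ⁅diagonal x, Uᵀ * normalized A b * U⁆ -
        fip (Uᵀ * normalized A b * U) (Uᵀ * normalized A b * U)) := by
    simpa only [← hx, lie_conj hU, fip_conj hU] using h1
  refine ⟨hx1, two_le_excess_of_weighted_sum (E := fun b => Uᵀ * normalized A b * U) hE ho' hn' hp
    (fun b _ => fip_self_nonneg _) (fun b _ => hmax b) h2, fun b hb hpos i j hij => ?_⟩
  exact entry_eq_zero_of_weighted_sum (E := fun b => Uᵀ * normalized A b * U) hx1.le hE ho' hn' hp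
    (fun b _ => fip_self_nonneg _) (fun b _ => hmax b) h2 (by simp [hb]) hpos hij

/-- Orthogonal tuples of real symmetric matrices for which the DDVV inequality is sharp. -/
theorem exists_of_extremal {A : κ → Matrix ι ι ℝ} (hA : ∀ a, (A a).IsSymm)
    (ho : ∀ a b, a ≠ b → fip (A a) (A b) = 0) (heq : lieTotal A = normTotal A ^ 2)
    (hne : ∃ a, A a ≠ 0) :
    ∃ q p : κ, q ≠ p ∧ ∃ U ∈ orthogonalGroup ι ℝ, ∃ i j : ι, i ≠ j ∧ ∃ l y : ℝ, 0 < l ∧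
      (y = l ∨ y = -l) ∧
      (Uᵀ * A q * U = diagonal fun k => if k = i then l else if k = j then -l else 0) ∧
      Uᵀ * A p * U = pairMatrix i j y ∧ ∀ r, r ≠ q → r ≠ p → A r = 0 := by
  obtain ⟨a₀, ha₀⟩ := hne
  obtain ⟨p, -, hp⟩ := Finset.exists_max_image Finset.univ (fun a => fip (A a) (A a))
    ⟨a₀, Finset.mem_univ _⟩
  have hpmax : ∀ b, fip (A b) (A b) ≤ fip (A p) (A p) := fun b => hp b (Finset.mem_univ _)
  have hppos : 0 < fip (A p) (A p) :=
    lt_of_lt_of_le (lt_of_le_of_ne (fip_self_nonneg _)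
      fun h => ha₀ (fip_self_eq_zero.1 h.symm)) (hpmax a₀)
  have hlow := le_weighted_sum_of_extremal hA ho heq hppos
  have hnon : (Finset.univ.erase p).Nonempty := by
    rw [Finset.nonempty_iff_ne_empty]
    intro h
    rw [h, Finset.sum_empty] at hlow
    linarith
  obtain ⟨q, hq, hqmax'⟩ := Finset.exists_max_image _ (fun a => fip (A a) (A a)) hnon
  have hqp : q ≠ p := (Finset.mem_erase.1 hq).1
  -- Lu's inequality with `w` the largest squared norm among the other members bounds that of `A p`,
  -- so `q` ties with `p` and sharpness can be used at either.
  have hpq : fip (A p) (A p) ≤ fip (A q) (A q) :=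
    hlow.trans (weighted_sum_le (isSymm_normalized hA p) (fip_normalized_self_le A p)
      (isSymm_normalized hA) (fip_normalized_ne ho) (fip_normalized_self_le A)
      (fip_self_nonneg _) (fun b _ => fip_self_nonneg _) hqmax')
  have hqpos := hppos.trans_le hpq
  have hqmax : ∀ b, fip (A b) (A b) ≤ fip (A q) (A q) := fun b => (hpmax b).trans hpq
  have hnorm : fip (A p) (A p) = fip (A q) (A q) := le_antisymm hpq (hpmax q)
  have htr : (normalized A q * normalized A q * normalized A q).trace = 0 := by
    obtain ⟨V, hV, z, hz⟩ := exists_orthogonal_diagonal (isSymm_normalized hA p)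
    obtain ⟨hz1, -, hz3⟩ := extremal_in_eigenbasis hA ho heq hppos hpmax hV hz
    rw [← trace_cube_conj hV]
    exact trace_cube_eq_zero hz1.le (hz3 q hqp hqpos)
  obtain ⟨U, hU, x, hx⟩ := exists_orthogonal_diagonal (isSymm_normalized hA q)
  obtain ⟨hx1, hx2, hx3⟩ := extremal_in_eigenbasis hA ho heq hqpos hqmax hU hx
  have hcube : ∑ i, x i ^ 3 = 0 := by
    rw [← trace_cube_conj hU, hx, diagonal_mul_diagonal, diagonal_mul_diagonal,
      trace_diagonal] at htr
    rw [← htr]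
    exact Finset.sum_congr rfl fun i _ => by ring
  obtain ⟨i, j, hij, hxi, hxi2, hxj, hxk⟩ := exists_of_two_le_excess hx1.le hx2 hcube
  -- With values `±1/√2` and zeros, every gap other than that between `i` and `j` is below one.
  have hgap : ∀ k l, ¬((k = i ∧ l = j) ∨ (k = j ∧ l = i)) → (x k - x l) ^ 2 < 1 := by
    intro k l hkl
    by_cases hki : k = i
    · by_cases hli : l = i
      · simp [hki, hli]
      · have hlj : l ≠ j := fun h => hkl (Or.inl ⟨hki, h⟩)
        rw [hki, hxk l hli hlj]; nlinarith
    · by_cases hkj : k = j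
      · have hli : l ≠ i := fun h => hkl (Or.inr ⟨hkj, h⟩)
        by_cases hlj : l = j
        · simp [hkj, hlj]
        · rw [hkj, hxj, hxk l hli hlj]; nlinarith
      · rw [hxk k hki hkj]
        by_cases hli : l = i
        · rw [hli]; nlinarith
        · by_cases hlj : l = j
          · rw [hlj, hxj]; nlinarith
          · rw [hxk l hli hlj]; norm_num
  have hpair : ∀ b, b ≠ q → Uᵀ * A b * U = pairMatrix i j ((Uᵀ * A b * U) i j) := by
    intro b hb
    refine eq_pairMatrix (isSymm_transpose_mul_mul (hA b) U) fun k l hkl => ?_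
    rcases (fip_self_nonneg (A b)).eq_or_lt with h0 | hpos
    · rw [fip_self_eq_zero.1 h0.symm]; simp
    · rw [← sqrt_smul_normalized A b, Matrix.mul_smul, Matrix.smul_mul, Matrix.smul_apply,
        hx3 b hb hpos k l (hgap k l hkl), smul_zero]
  set s := √(fip (A q) (A q)) with hs
  have hspos : 0 < s := Real.sqrt_pos.2 hqpos
  have hs2 : s ^ 2 = fip (A q) (A q) := Real.sq_sqrt (fip_self_nonneg _)
  set y := (Uᵀ * A p * U) i j with hy
  have hy2 : 2 * (y * y) = s ^ 2 := by
    rw [hs2, ← hnorm, ← fip_pairMatrix hij, ← hpair p hqp.symm, fip_conj hU]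
  have hyl : y = s * x i ∨ y = -(s * x i) := by
    rw [← sq_eq_sq_iff_eq_or_eq_neg]
    linear_combination (1 / 2) * hy2 - (s ^ 2 / 2) * hxi2
  refine ⟨q, p, hqp, U, hU, i, j, hij, s * x i, y, mul_pos hspos hxi, hyl, ?_,
    hpair p hqp.symm, fun r hrq hrp => ?_⟩
  · rw [← sqrt_smul_normalized A q, Matrix.mul_smul, Matrix.smul_mul, hx, ← diagonal_smul]
    congr 1
    ext k
    rw [Pi.smul_apply, smul_eq_mul]
    split_ifs with h1 h2
    · rw [h1]
    · rw [h2, hxj, mul_neg]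
    · rw [hxk k h1 h2, mul_zero]
  -- `A r` and `A p` are multiples of the same matrix in this basis, and `A p` is nonzero.
  · have h1 := ho r p hrp
    rw [← fip_conj hU, hpair r hrq, hpair p hqp.symm, fip_pairMatrix hij] at h1
    have hy0 : y ≠ 0 := by
      rintro h
      rw [h] at hy2
      nlinarith
    have h2 : (Uᵀ * A r * U) i j = 0 := by
      have := (mul_eq_zero.1 h1).resolve_left two_ne_zero
      exact (mul_eq_zero.1 this).resolve_right hy0
    rw [← fip_self_eq_zero, ← fip_conj hU, hpair r hrq, fip_pairMatrix hij, h2]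
    norm_num

end RealInequality

open Matrix

/-! ### From complex symmetric to real symmetric tuples -/

section RealAndImaginaryParts

variable {ι : Type*} [Fintype ι]

/-- The entrywise real part. -/
def reMat (B : Matrix ι ι ℂ) : Matrix ι ι ℝ := B.map Complex.re

/-- The entrywise imaginary part. -/
def imMat (B : Matrix ι ι ℂ) : Matrix ι ι ℝ := B.map Complex.im

theorem norm_sq_eq_fip (B : Matrix ι ι ℂ) :
    ‖B‖ ^ 2 = fip (reMat B) (reMat B) + fip (imMat B) (imMat B) := by
  have h0 : 0 ≤ ∑ i, ∑ j, ‖B i j‖ ^ (2 : ℝ) := by positivity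
  rw [Matrix.frobenius_norm_def, ← Real.rpow_natCast, ← Real.rpow_mul h0]
  norm_num
  simp only [fip, ← Finset.sum_add_distrib]
  refine Finset.sum_congr rfl fun i _ => Finset.sum_congr rfl fun j _ => ?_
  rw [Complex.sq_norm, Complex.normSq_apply]
  rfl

theorem reMat_lie (A B : Matrix ι ι ℂ) :
    reMat ⁅A, B⁆ = ⁅reMat A, reMat B⁆ - ⁅imMat A, imMat B⁆ := by
  ext i j
  simp [reMat, imMat, Ring.lie_def, Matrix.mul_apply, Finset.sum_sub_distrib]
  ring

theorem imMat_lie (A B : Matrix ι ι ℂ) :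
    imMat ⁅A, B⁆ = ⁅reMat A, imMat B⁆ + ⁅imMat A, reMat B⁆ := by
  ext i j
  simp [reMat, imMat, Ring.lie_def, Matrix.mul_apply, Finset.sum_add_distrib]
  ring

theorem trace_lie_mul (X Z V : Matrix ι ι ℝ) : (⁅X, Z⁆ * V).trace = (X * ⁅Z, V⁆).trace := by
  rw [Ring.lie_def, Ring.lie_def, Matrix.sub_mul, Matrix.mul_sub, trace_sub, trace_sub,
    Matrix.mul_assoc, Matrix.mul_assoc Z X V, trace_mul_comm Z, Matrix.mul_assoc]

theorem fip_lie_lie {X Z : Matrix ι ι ℝ} (hX : X.IsSymm) (hZ : Z.IsSymm) (V : Matrix ι ι ℝ) :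
    fip ⁅X, Z⁆ V = -(X * ⁅Z, V⁆).trace := by
  have : ⁅X, Z⁆ᵀ = -⁅X, Z⁆ := by
    rw [Ring.lie_def, transpose_sub, transpose_mul, transpose_mul, hX.eq, hZ.eq, neg_sub]
  rw [fip_eq_trace, this, Matrix.neg_mul, trace_neg, trace_lie_mul]

/-- Commutators of symmetric matrices are skew, so every pairing becomes minus the trace of `X`
times a double commutator; the claim is the Jacobi identity traced against `X`. -/
theorem fip_lie_jacobi {X Y Z W : Matrix ι ι ℝ} (hX : X.IsSymm) (hY : Y.IsSymm) (hZ : Z.IsSymm)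
    (hW : W.IsSymm) :
    fip ⁅X, Z⁆ ⁅Y, W⁆ - fip ⁅X, W⁆ ⁅Y, Z⁆ = fip ⁅X, Y⁆ ⁅Z, W⁆ := by
  rw [fip_lie_lie hX hZ, fip_lie_lie hX hW, fip_lie_lie hX hY]
  have : X * ⁅Y, ⁅Z, W⁆⁆ = X * ⁅Z, ⁅Y, W⁆⁆ - X * ⁅W, ⁅Y, Z⁆⁆ := by
    simp only [Ring.lie_def]
    noncomm_ring
  rw [this, trace_sub]
  ring

theorem fip_add_self (X Y : Matrix ι ι ℝ) :
    fip (X + Y) (X + Y) = fip X X + fip Y Y + 2 * fip X Y := by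
  simp only [fip, Matrix.add_apply, Finset.mul_sum, ← Finset.sum_add_distrib]
  exact Finset.sum_congr rfl fun _ _ => Finset.sum_congr rfl fun _ _ => by ring

theorem fip_sub_self (X Y : Matrix ι ι ℝ) :
    fip (X - Y) (X - Y) = fip X X + fip Y Y - 2 * fip X Y := by
  simp only [fip, Matrix.sub_apply, Finset.mul_sum, ← Finset.sum_add_distrib,
    ← Finset.sum_sub_distrib]
  exact Finset.sum_congr rfl fun _ _ => Finset.sum_congr rfl fun _ _ => by ring

/-- The real and imaginary parts of a tuple of complex matrices. -/
def parts {m : ℕ} (B : Fin m → Matrix ι ι ℂ) : Fin (m + m) → Matrix ι ι ℝ :=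
  Fin.append (fun r => reMat (B r)) fun r => imMat (B r)

variable {m : ℕ}

theorem normTotal_parts (B : Fin m → Matrix ι ι ℂ) : normTotal (parts B) = ∑ r, ‖B r‖ ^ 2 := by
  simp only [normTotal, parts, Fin.sum_univ_add, Fin.append_left, Fin.append_right,
    norm_sq_eq_fip, Finset.sum_add_distrib]

omit [Fintype ι] in
theorem isSymm_parts {B : Fin m → Matrix ι ι ℂ} (hB : ∀ r, (B r).IsSymm) (k : Fin (m + m)) :
    (parts B k).IsSymm := by
  refine Fin.addCases (fun r => ?_) (fun r => ?_) k
  · rw [parts, Fin.append_left]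
    exact (hB r).map _
  · rw [parts, Fin.append_right]
    exact (hB r).map _

/-- The cross terms of `‖[B r, B s]‖²` combine by `fip_lie_jacobi` into `-2⟨[X r, Y r], [X s, Y
s]⟩`, whose double sum is a single square. -/
theorem sum_norm_lie_sq (B : Fin m → Matrix ι ι ℂ) (hB : ∀ r, (B r).IsSymm) :
    ∑ r, ∑ s, ‖⁅B r, B s⁆‖ ^ 2 + 2 * fip (∑ r, ⁅reMat (B r), imMat (B r)⁆)
      (∑ r, ⁅reMat (B r), imMat (B r)⁆) = lieTotal (parts B) := by
  have hre : ∀ r, (reMat (B r)).IsSymm := fun r => (hB r).map _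
  have him : ∀ r, (imMat (B r)).IsSymm := fun r => (hB r).map _
  have h1 : fip (∑ r, ⁅reMat (B r), imMat (B r)⁆) (∑ r, ⁅reMat (B r), imMat (B r)⁆) =
      ∑ r, ∑ s, fip ⁅reMat (B r), imMat (B r)⁆ ⁅reMat (B s), imMat (B s)⁆ := by
    simp only [fip_sum_left, fip_sum_right]
    exact Finset.sum_comm
  rw [h1, Finset.mul_sum, ← Finset.sum_add_distrib]
  simp only [lieTotal, parts, Fin.sum_univ_add, Fin.append_left, Fin.append_right,
    ← Finset.sum_add_distrib]
  refine Finset.sum_congr rfl fun r _ => ?_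
  rw [Finset.mul_sum, ← Finset.sum_add_distrib]
  refine Finset.sum_congr rfl fun s _ => ?_
  rw [norm_sq_eq_fip, reMat_lie, imMat_lie, fip_add_self, fip_sub_self,
    ← fip_lie_jacobi (hre r) (him r) (hre s) (him s)]
  ring

end RealAndImaginaryParts

/-! ### Translation between the complex statement and real matrices -/

section Bridge

variable {n m M : ℕ}

theorem rePart_eq (B : Matrix (Fin n) (Fin n) ℂ) :
    rePart B = (reMat B).map Complex.ofReal := by
  ext i j
  simp only [rePart, conjMatrix, reMat, Matrix.smul_apply, Matrix.add_apply, Matrix.map_apply,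
    smul_eq_mul, Complex.add_conj]
  push_cast
  ring

theorem imPart_eq (B : Matrix (Fin n) (Fin n) ℂ) :
    imPart B = (imMat B).map Complex.ofReal := by
  ext i j
  simp only [imPart, conjMatrix, imMat, Matrix.smul_apply, Matrix.sub_apply, Matrix.map_apply,
    smul_eq_mul, Complex.sub_conj]
  push_cast
  field_simp

theorem append_parts (B : Fin m → Matrix (Fin n) (Fin n) ℂ) :
    Fin.append (fun r => rePart (B r)) (fun r => imPart (B r)) =
      fun k => (parts B k).map Complex.ofReal := by
  ext1 k
  refine Fin.addCases (fun r => ?_) (fun r => ?_) k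
  · rw [parts, Fin.append_left, Fin.append_left, rePart_eq]
  · rw [parts, Fin.append_right, Fin.append_right, imPart_eq]

/-- This is `[X + iY, X - iY] = -2i[X, Y]`. -/
theorem lie_conjMatrix (B : Matrix (Fin n) (Fin n) ℂ) :
    ⁅B, conjMatrix B⁆ = (-2 * Complex.I) • (⁅reMat B, imMat B⁆).map Complex.ofReal := by
  ext i j
  apply Complex.ext
  · simp [conjMatrix, reMat, imMat, Ring.lie_def, Matrix.mul_apply, Finset.mul_sum,
      ← Finset.sum_sub_distrib]
  · simp [conjMatrix, reMat, imMat, Ring.lie_def, Matrix.mul_apply, Finset.mul_sum,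
      ← Finset.sum_sub_distrib]
    rw [← Finset.sum_neg_distrib]
    exact Finset.sum_congr rfl fun _ _ => by ring

theorem sum_lie_conjMatrix_eq_zero (B : Fin m → Matrix (Fin n) (Fin n) ℂ) :
    ∑ r, ⁅B r, conjMatrix (B r)⁆ = 0 ↔ ∑ r, ⁅reMat (B r), imMat (B r)⁆ = 0 := by
  have : ∑ r, ⁅B r, conjMatrix (B r)⁆ =
      (-2 * Complex.I) • (∑ r, ⁅reMat (B r), imMat (B r)⁆).map Complex.ofReal := by
    simp only [lie_conjMatrix, ← Finset.smul_sum]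
    congr 1
    ext i j
    simp [Matrix.sum_apply]
  rw [this, smul_eq_zero_iff_right (by simp)]
  constructor
  · intro h
    ext i j
    simpa using congrFun (congrFun h i) j
  · intro h
    rw [h]
    ext i j
    simp

theorem kAct_map (P : Matrix (Fin n) (Fin n) ℝ) (R : Matrix (Fin M) (Fin M) ℝ)
    (A : Fin M → Matrix (Fin n) (Fin n) ℝ) (k : Fin M) :
    kAct (P.map Complex.ofReal) R (fun j => (A j).map Complex.ofReal) k =
      (Pᵀ * recombine R A k * P).map Complex.ofReal := by
  have hP : (P.map Complex.ofReal)ᴴ = Pᵀ.map Complex.ofReal := by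
    ext i j
    simp
  have hmul : ∀ X Y : Matrix (Fin n) (Fin n) ℝ,
      X.map Complex.ofReal * Y.map Complex.ofReal = (X * Y).map Complex.ofReal := fun X Y =>
    (Matrix.map_mul (f := Complex.ofRealHom)).symm
  simp only [kAct, hP, hmul, recombine, Finset.mul_sum, Finset.sum_mul, Matrix.mul_smul,
    Matrix.smul_mul]
  ext i j
  simp [Matrix.sum_apply]

/-- The real matrix `diag(l, -l, 0, …, 0)`. -/
def realDiag (hn : 2 ≤ n) (l : ℝ) : Matrix (Fin n) (Fin n) ℝ :=
  diagonal fun k => if k = ⟨0, by omega⟩ then l else if k = ⟨1, by omega⟩ then -l else 0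

theorem diagZero_H₁ (hn : 2 ≤ n) (l : ℝ) :
    diagZero n (H₁ l) = (realDiag hn l).map Complex.ofReal := by
  ext ⟨i, hi⟩ ⟨j, hj⟩
  simp only [diagZero, H₁, realDiag, Matrix.of_apply, Matrix.map_apply, Matrix.diagonal_apply,
    Fin.mk.injEq]
  rcases i with _ | _ | i <;> rcases j with _ | _ | j <;> simp

theorem diagZero_H₂ (hn : 2 ≤ n) (l : ℝ) :
    diagZero n (H₂ l) =
      (pairMatrix (⟨0, by omega⟩ : Fin n) ⟨1, by omega⟩ l).map Complex.ofReal := by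
  ext ⟨i, hi⟩ ⟨j, hj⟩
  simp only [diagZero, H₂, pairMatrix, Matrix.of_apply, Matrix.map_apply, Fin.mk.injEq]
  rcases i with _ | _ | i <;> rcases j with _ | _ | j <;> simp

theorem map_ofReal_injective {X Y : Matrix (Fin n) (Fin n) ℝ}
    (h : X.map Complex.ofReal = Y.map Complex.ofReal) : X = Y :=
  Matrix.map_injective Complex.ofReal_injective h

end Bridge

/-! ### Reduction to the standard form and its converse -/

section Equality

variable {n M : ℕ}

theorem exists_perm_two {α : Type*} [DecidableEq α] {a b i j : α} (hab : a ≠ b) (hij : i ≠ j) :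
    ∃ σ : Equiv.Perm α, σ a = i ∧ σ b = j := by
  refine ⟨(Equiv.swap b (Equiv.swap a i j)).trans (Equiv.swap a i), ?_, ?_⟩
  · have h : a ≠ Equiv.swap a i j := by
      intro h
      have h' := congrArg (Equiv.swap a i) h
      rw [Equiv.swap_apply_left, Equiv.swap_apply_self] at h'
      exact hij h'
    rw [Equiv.trans_apply, Equiv.swap_apply_of_ne_of_ne hab h, Equiv.swap_apply_left]
  · rw [Equiv.trans_apply, Equiv.swap_apply_left, Equiv.swap_apply_self]

theorem submatrix_mem_orthogonalGroup {ι : Type*} [Fintype ι] [DecidableEq ι] {U : Matrix ι ι ℝ}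
    (hU : U ∈ orthogonalGroup ι ℝ) (σ : Equiv.Perm ι) :
    U.submatrix id σ ∈ orthogonalGroup ι ℝ := by
  rw [mem_orthogonalGroup_iff] at hU ⊢
  rw [transpose_submatrix, submatrix_mul_equiv, hU, submatrix_id_id]

theorem mul_diagonal_sign_mem {ι : Type*} [Fintype ι] [DecidableEq ι] {U : Matrix ι ι ℝ}
    (hU : U ∈ orthogonalGroup ι ℝ) {ε : ι → ℝ} (hε : ∀ i, ε i * ε i = 1) :
    U * diagonal ε ∈ orthogonalGroup ι ℝ := by
  refine Submonoid.mul_mem _ hU ?_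
  rw [mem_orthogonalGroup_iff, diagonal_transpose, diagonal_mul_diagonal, ← diagonal_one]
  congr 1
  ext i
  simpa using hε i

/-- Extremal tuples of real symmetric matrices can be brought to the standard form. -/
theorem exists_kAct_eq_standardTuple (hn : 2 ≤ n) {C : Fin M → Matrix (Fin n) (Fin n) ℝ}
    (hC : ∀ k, (C k).IsSymm) (heq : lieTotal C = normTotal C ^ 2) :
    ∃ P ∈ orthogonalGroup (Fin n) ℝ, ∃ R ∈ orthogonalGroup (Fin M) ℝ, ∃ l : ℝ, 0 ≤ l ∧
      kAct (P.map Complex.ofReal) R (fun k => (C k).map Complex.ofReal) =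
        standardTuple n M l := by
  obtain ⟨R, hR, ho⟩ := exists_recombine_orthogonal C
  by_cases hne : ∃ a, recombine R C a ≠ 0
  -- The zero tuple takes `l = 0`; this also covers `M < 2`, where no two distinct indices exist.
  swap
  · push Not at hne
    refine ⟨1, one_mem _, R, hR, 0, le_rfl, ?_⟩
    ext k i j
    rw [kAct_map, hne k, standardTuple, diagZero_H₁ hn, diagZero_H₂ hn]
    split_ifs <;> simp [realDiag, pairMatrix]
  obtain ⟨q, p, hqp, U, hU, i, j, hij, l, y, hl, hy, hdiag, hpair, hrest⟩ :=
    exists_of_extremal (isSymm_recombine hC R) ho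
      (by rw [lieTotal_recombine hR, normTotal_recombine hR, heq]) hne
  have hM : 2 ≤ M := by
    by_contra! h
    exact hqp (Fin.ext (by omega))
  set n0 : Fin n := ⟨0, by omega⟩ with hn0
  set n1 : Fin n := ⟨1, by omega⟩ with hn1
  set m0 : Fin M := ⟨0, by omega⟩ with hm0
  set m1 : Fin M := ⟨1, by omega⟩ with hm1
  have hn01 : n0 ≠ n1 := by simp [hn0, hn1]
  have hm01 : m0 ≠ m1 := by simp [hm0, hm1]
  obtain ⟨σ, hσ0, hσ1⟩ := exists_perm_two hn01 hij
  obtain ⟨τ, hτ0, hτ1⟩ := exists_perm_two hm01 hqp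
  -- The sign of the off-diagonal entry is absorbed by negating a column of `R`.
  obtain ⟨e, hee, hey⟩ : ∃ e : ℝ, e * e = 1 ∧ e * y = l := by
    rcases hy with rfl | rfl
    exacts [⟨1, by norm_num, by ring⟩, ⟨-1, by norm_num, by ring⟩]
  set ε : Fin M → ℝ := fun k => if k = m1 then e else 1 with hε
  have hε1 : ∀ k, ε k * ε k = 1 := fun k => by
    simp only [hε]
    split_ifs
    exacts [hee, one_mul 1]
  refine ⟨U.submatrix id σ, submatrix_mem_orthogonalGroup hU σ,
    R.submatrix id τ * diagonal ε,
    mul_diagonal_sign_mem (submatrix_mem_orthogonalGroup hR τ) hε1, l, hl.le, ?_⟩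
  have hact : ∀ k, (U.submatrix id σ)ᵀ * recombine (R.submatrix id τ * diagonal ε) C k *
      U.submatrix id σ = ε k • (Uᵀ * recombine R C (τ k) * U).submatrix σ σ := by
    intro k
    have h1 : recombine (R.submatrix id τ * diagonal ε) C k = ε k • recombine R C (τ k) := by
      simp only [recombine, mul_diagonal, submatrix_apply, id, Finset.smul_sum, smul_smul, mul_comm]
    rw [h1, Matrix.mul_smul, Matrix.smul_mul]
    rfl
  have hσi : ∀ k, σ k = i ↔ k = n0 := fun k => by rw [← hσ0, σ.injective.eq_iff]
  have hσj : ∀ k, σ k = j ↔ k = n1 := fun k => by rw [← hσ1, σ.injective.eq_iff]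
  funext k
  rw [kAct_map, hact]
  by_cases hk0 : k = m0
  · have hεk : ε k = 1 := by simp [hε, hk0, hm01]
    rw [hεk, one_smul, hk0, hτ0, hdiag, standardTuple, if_pos rfl, diagZero_H₁ hn]
    congr 1
    ext a b
    simp only [submatrix_apply, diagonal_apply, realDiag, σ.injective.eq_iff, hσi, hσj, hn0, hn1]
  · by_cases hk1 : k = m1
    · have hεk : ε k = e := by simp [hε, hk1]
      rw [hεk, hk1, hτ1, hpair, standardTuple, if_neg (by simp [hm1]), if_pos rfl,
        diagZero_H₂ hn]
      congr 1
      ext a b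
      simp only [Matrix.smul_apply, submatrix_apply, pairMatrix, of_apply, hσi, hσj, smul_eq_mul,
        mul_ite, hey, mul_zero, hn0, hn1]
    · have hq : τ k ≠ q := fun h => hk0 (τ.injective (h.trans hτ0.symm))
      have hp : τ k ≠ p := fun h => hk1 (τ.injective (h.trans hτ1.symm))
      have hv0 : k.val ≠ 0 := fun h => hk0 (Fin.ext h)
      have hv1 : k.val ≠ 1 := fun h => hk1 (Fin.ext h)
      rw [hrest _ hq hp, standardTuple, if_neg hv0, if_neg hv1]
      ext a b
      simp

theorem fip_realDiag (hn : 2 ≤ n) (l : ℝ) : fip (realDiag hn l) (realDiag hn l) = 2 * l ^ 2 := by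
  have hne : (⟨0, by omega⟩ : Fin n) ≠ ⟨1, by omega⟩ := by simp
  rw [realDiag, fip_diagonal, Fintype.sum_eq_add _ _ hne]
  · simp
    ring
  · rintro k ⟨h0, h1⟩
    simp [h0, h1]

theorem fip_lie_realDiag_pairMatrix (hn : 2 ≤ n) (l : ℝ) :
    fip ⁅realDiag hn l, pairMatrix (⟨0, by omega⟩ : Fin n) ⟨1, by omega⟩ l⁆
      ⁅realDiag hn l, pairMatrix (⟨0, by omega⟩ : Fin n) ⟨1, by omega⟩ l⁆ = 8 * l ^ 4 := by
  have hne : (⟨0, by omega⟩ : Fin n) ≠ ⟨1, by omega⟩ := by simp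
  -- At `(0, 1)` and `(1, 0)` the gap is `±2l` and the entry `l`, so the commutator has squared
  -- entry `(2l²)²` there.
  have h8 : 8 * l ^ 4 = 2 * (2 * l ^ 2 * (2 * l ^ 2)) := by ring
  rw [h8, ← fip_pairMatrix hne, realDiag, fip_lie_diagonal]
  refine Finset.sum_congr rfl fun i _ => Finset.sum_congr rfl fun j _ => ?_
  simp only [pairMatrix, of_apply]
  split_ifs with h1 h2 h3 h4 h5 <;> first | (simp_all; done) | (simp_all; ring)

/-- Both totals are invariant under `P` and `R`, so they can be read off the standard pair: `2 * 8l⁴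
= (4l²)²`. -/
theorem lieTotal_eq_of_kAct_eq (hn : 2 ≤ n) (hM : 2 ≤ M) {C : Fin M → Matrix (Fin n) (Fin n) ℝ}
    {P : Matrix (Fin n) (Fin n) ℝ} (hP : P ∈ orthogonalGroup (Fin n) ℝ)
    {R : Matrix (Fin M) (Fin M) ℝ} (hR : R ∈ orthogonalGroup (Fin M) ℝ) {l : ℝ}
    (h : kAct (P.map Complex.ofReal) R (fun k => (C k).map Complex.ofReal) =
      standardTuple n M l) : lieTotal C = normTotal C ^ 2 := by
  set m0 : Fin M := ⟨0, by omega⟩ with hm0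
  set m1 : Fin M := ⟨1, by omega⟩ with hm1
  have hm01 : m0 ≠ m1 := by simp [hm0, hm1]
  set D : Fin M → Matrix (Fin n) (Fin n) ℝ := fun k => Pᵀ * recombine R C k * P with hD
  have hDk : ∀ k, (D k).map Complex.ofReal = standardTuple n M l k := fun k => by
    rw [← h, kAct_map]
  have hD0 : D m0 = realDiag hn l := map_ofReal_injective (by
    rw [hDk, standardTuple, if_pos rfl, diagZero_H₁ hn])
  have hD1 : D m1 = pairMatrix ⟨0, by omega⟩ ⟨1, by omega⟩ l := map_ofReal_injective (by
    rw [hDk, standardTuple, if_neg (by simp [hm1]), if_pos rfl, diagZero_H₂ hn])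
  have hDr : ∀ k, k ≠ m0 ∧ k ≠ m1 → D k = 0 := fun k hk => map_ofReal_injective (by
    rw [hDk, standardTuple, if_neg fun h => hk.1 (Fin.ext h), if_neg fun h => hk.2 (Fin.ext h)]
    ext; simp)
  have hne : (⟨0, by omega⟩ : Fin n) ≠ ⟨1, by omega⟩ := by simp
  have hnorm : normTotal C = 4 * l ^ 2 := by
    have : normTotal C = normTotal D := by
      rw [← normTotal_recombine hR]
      simp only [normTotal, hD, fip_conj hP]
    rw [this, normTotal, Fintype.sum_eq_add m0 m1 hm01 fun k hk => by
      rw [hDr k hk, fip_self_eq_zero], hD0, hD1, fip_realDiag, fip_pairMatrix hne]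
    ring
  have hlie : lieTotal C = 16 * l ^ 4 := by
    have : lieTotal C = lieTotal D := by
      rw [← lieTotal_recombine hR]
      simp only [lieTotal, hD, lie_conj hP, fip_conj hP]
    have hz : ∀ X Y : Matrix (Fin n) (Fin n) ℝ, X = 0 ∨ Y = 0 ∨ X = Y →
        fip ⁅X, Y⁆ ⁅X, Y⁆ = 0 := by
      rintro X Y (rfl | rfl | rfl) <;> simp [fip_self_eq_zero, Ring.lie_def]
    rw [this, lieTotal, Fintype.sum_eq_add m0 m1 hm01 fun k hk =>
        Finset.sum_eq_zero fun b _ => hz _ _ (Or.inl (hDr k hk)),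
      Fintype.sum_eq_add m0 m1 hm01 fun k hk => hz _ _ (Or.inr (Or.inl (hDr k hk))),
      Fintype.sum_eq_add m0 m1 hm01 fun k hk => hz _ _ (Or.inr (Or.inl (hDr k hk))),
      hz (D m0) (D m0) (by simp), hz (D m1) (D m1) (by simp), fip_lie_comm (D m1), hD0, hD1,
      fip_lie_realDiag_pairMatrix]
    ring
  rw [hnorm, hlie]
  ring

end Equality

end ComplexDDVV

theorem corollary2p4 (n m : ℕ) (hn : 2 ≤ n)
    (B : Fin m → Matrix (Fin n) (Fin n) ℂ) (hB : ∀ r, (B r).IsSymm) :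
    (∑ r, ∑ s, ‖⁅B r, B s⁆‖ ^ 2 ≤ (∑ r, ‖B r‖ ^ 2) ^ 2) ∧
    (∑ r, ∑ s, ‖⁅B r, B s⁆‖ ^ 2 = (∑ r, ‖B r‖ ^ 2) ^ 2 ↔
      ∑ r, ⁅B r, ComplexDDVV.conjMatrix (B r)⁆ = 0 ∧
      ∃ P ∈ Matrix.orthogonalGroup (Fin n) ℝ, ∃ R ∈ Matrix.orthogonalGroup (Fin (m + m)) ℝ,
        ∃ l : ℝ, 0 ≤ l ∧
          ComplexDDVV.kAct (P.map Complex.ofReal) R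
              (Fin.append (fun r => ComplexDDVV.rePart (B r))
                (fun r => ComplexDDVV.imPart (B r))) =
            ComplexDDVV.standardTuple n (m + m) l) := by
  have hsum := ComplexDDVV.sum_norm_lie_sq B hB
  have hle := ComplexDDVV.lieTotal_le_normTotal_sq (ComplexDDVV.isSymm_parts hB)
  have hnn := ComplexDDVV.fip_self_nonneg
    (∑ r, ⁅ComplexDDVV.reMat (B r), ComplexDDVV.imMat (B r)⁆)
  rw [ComplexDDVV.append_parts, ComplexDDVV.sum_lie_conjMatrix_eq_zero,
    ← ComplexDDVV.normTotal_parts]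
  -- The complex sum plus a nonnegative defect is `lieTotal`, which is at most the squared norm
  -- total; equality forces both a zero defect and real extremality.
  refine ⟨by linarith, fun heq => ⟨?_, ?_⟩, ?_⟩
  · exact ComplexDDVV.fip_self_eq_zero.1 (by linarith)
  · exact ComplexDDVV.exists_kAct_eq_standardTuple hn (ComplexDDVV.isSymm_parts hB) (by linarith)
  · rintro ⟨h0, P, hP, R, hR, l, -, h⟩
    rw [ComplexDDVV.fip_self_eq_zero.2 h0] at hsum
    -- For `m = 0` the standard tuple has no room for its two blocks, but both sides vanish.
    rcases Nat.eq_zero_or_pos m with rfl | hm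
    · simp [ComplexDDVV.normTotal]
    · rw [← ComplexDDVV.lieTotal_eq_of_kAct_eq hn (by omega) hP hR h]
      linarith
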